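/- **Theorem (Eigenvector delocalization).** For $N\ge 1$ let $W_N$ be the random symmetric $N\times N$ matrix with $W_N(j,\ell)=X_{j\wedge\ell,\,j\vee\ell}$, where $\{X_{j,\ell}=X^{(N)}_{j,\ell}:1\le j\le \ell\le N\}$ are independent real random variables with mean $0$ and variance $f(j/N,\ell/N)$ for a fixed bounded Riemann-integrable $f:[0,1]^2\to[0,\infty)$, and assume that there is a constant $B>0$ with $\mathbb E|X_{j,\ell}|^m\le m^{Bm}$ for all integers $m\ge1$ and all $N,j,\ell$. Fix $k\ge1$, $\alpha_1>\cdots>\alpha_k>0$ and functions $h_1,\dots,h_k:[0,1]\to\mathbb R$, let $\theta_N>0$, put $e_i=N^{-1/2}\,(h_i(1/N),h_i(2/N),\dots,h_i(1))'\in\mathbb R^N$ and $$A_N=W_N+\theta_N\sum_{i=1}^k\alpha_i\,e_ie_i' .$$ Assume: * (A1) for some $\xi>\max(4(B+1),8)$, $\sqrt N(\log N)^\xi=O(\theta_N)$ and $\theta_N=O(N)$ as $N\to\infty$; * (A2) $h_1,\dots,h_k$ are bounded and orthonormal in $L^2[0,1]$; * (A3) each $h_i$ is Lipschitz continuous on $[0,1]$.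 Events $E_N$ occur with high probability if $\mathbb P(E_N^c)=O(e^{-(\log N)^\eta})$ for some $\eta>1$; $Y_N=O_{hp}(Z_N)$ means that for some constant $C>0$, $|Y_N|\le C|Z_N|$ with high probability, and $Y_N=o_{hp}(Z_N)$ means that for every $\delta>0$, $|Y_N|\le\delta|Z_N|$ with high probability. Let $1\le i\le k$ and, for $N\ge i$, let $v_i$ be an eigenvector of $A_N$ of Euclidean norm one for its $i$-th largest eigenvalue $\lambda_i(A_N)$ (counted with multiplicity), with the sign chosen so that $e_i'v_i\ge0$. Then, as $N\to\infty$, $$\|v_i-e_i\|_\infty=O_{hp}\!\left(\frac{(\log N)^{\xi/4}}{\theta_N}\right),\qquad \|v_i-e_i\|_\infty=o_{hp}\!\left(\frac1{\sqrt N}\right),$$ and consequently $\max_{1\le\ell\le N}|v_i(\ell)|=O_{hp}(N^{-1/2})$. -/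

import Mathlib

open MeasureTheory ProbabilityTheory Filter Asymptotics
open scoped Matrix

namespace SpikedWigner

noncomputable section

/-- The grid point `j / N` of `[0,1]`, where the 1-based index `j` is stored as `j - 1 : Fin N`. -/
def gridPoint {N : ℕ} (j : Fin N) : ℝ := ((j : ℝ) + 1) / N

/-- The unit square as a box in `ℝ²`. -/
def unitSquare : BoxIntegral.Box (Fin 2) where
  lower := fun _ => 0
  upper := fun _ => 1
  lower_lt_upper := fun _ => zero_lt_one

/-- A variance profile: a nonnegative, bounded, Riemann integrable function on `[0,1]²`
(only the values of `f` on the closed unit square are relevant). -/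
structure IsVarianceProfile (f : ℝ → ℝ → ℝ) : Prop where
  nonneg : ∀ x ∈ Set.Icc (0 : ℝ) 1, ∀ y ∈ Set.Icc (0 : ℝ) 1, 0 ≤ f x y
  bounded : ∃ M : ℝ, ∀ x ∈ Set.Icc (0 : ℝ) 1, ∀ y ∈ Set.Icc (0 : ℝ) 1, f x y ≤ M
  riemannIntegrable :
    BoxIntegral.Integrable unitSquare BoxIntegral.IntegrationParams.Riemann
      (fun p : Fin 2 → ℝ => f (p 0) (p 1)) BoxIntegral.BoxAdditiveMap.volume

/-- The upper triangular entries `X j l`, `j ≤ l`, of a Wigner-type matrix of size `N`: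
independent centred random variables with `Var (X j l) = f (j/N, l/N)` and
`E |X j l| ^ m ≤ m ^ (B m)` for all integers `m ≥ 1`.
The values `X j l` with `l < j` play no role. -/
structure IsWignerArray {Ω : Type*} [MeasurableSpace Ω] (P : Measure Ω) {N : ℕ}
    (f : ℝ → ℝ → ℝ) (B : ℝ) (X : Fin N → Fin N → Ω → ℝ) : Prop where
  measurable : ∀ j l, j ≤ l → Measurable (X j l)
  indep : iIndepFun (fun (p : {p : Fin N × Fin N // p.1 ≤ p.2}) => X p.1.1 p.1.2) P
  mean : ∀ j l, j ≤ l → ∫ ω, X j l ω ∂P = 0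
  variance : ∀ j l, j ≤ l → ProbabilityTheory.variance (X j l) P = f (gridPoint j) (gridPoint l)
  integrable_moment : ∀ j l, j ≤ l → ∀ m : ℕ, 1 ≤ m → Integrable (fun ω => |X j l ω| ^ m) P
  moment_le : ∀ j l, j ≤ l → ∀ m : ℕ, 1 ≤ m →
    ∫ ω, |X j l ω| ^ m ∂P ≤ (m : ℝ) ^ (B * (m : ℝ))

/-- The symmetric matrix `W(j, l) = X (min j l) (max j l)` at the outcome `ω`. -/
def wignerMatrix {Ω : Type*} {N : ℕ} (X : Fin N → Fin N → Ω → ℝ) (ω : Ω) :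
    Matrix (Fin N) (Fin N) ℝ :=
  Matrix.of fun j l => X (min j l) (max j l) ω

/-- The discretization `(h(1/N), …, h(N/N)) / √N` of a function `h` on `[0,1]`. -/
def signalVector (N : ℕ) (h : ℝ → ℝ) : Fin N → ℝ :=
  fun j => h (gridPoint j) / Real.sqrt N

/-- The perturbed matrix `A = W + θ ∑ᵢ αᵢ eᵢ eᵢᵀ`, with `eᵢ` the discretization of `hᵢ`. -/
def perturbedMatrix {Ω : Type*} {N k : ℕ} (X : Fin N → Fin N → Ω → ℝ) (θ : ℝ)
    (α : Fin k → ℝ) (h : Fin k → ℝ → ℝ) (ω : Ω) : Matrix (Fin N) (Fin N) ℝ :=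
  wignerMatrix X ω +
    θ • ∑ i, α i • Matrix.vecMulVec (signalVector N (h i)) (signalVector N (h i))

theorem perturbedMatrix_isHermitian {Ω : Type*} {N k : ℕ} (X : Fin N → Fin N → Ω → ℝ) (θ : ℝ)
    (α : Fin k → ℝ) (h : Fin k → ℝ → ℝ) (ω : Ω) :
    (perturbedMatrix X θ α h ω).IsHermitian := by
  ext j l
  simp [perturbedMatrix, wignerMatrix, Matrix.sum_apply, Matrix.vecMulVec_apply,
    min_comm, max_comm, mul_comm]

/-- The eigenvalue number `i`, counted from `0`, of a symmetric matrix, the eigenvalues being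
listed in decreasing order with multiplicity. -/
def orderedEigenvalue {N : ℕ} {A : Matrix (Fin N) (Fin N) ℝ} (hA : A.IsHermitian)
    (i : ℕ) (hi : i < N) : ℝ :=
  hA.eigenvalues₀ ⟨i, by simpa using hi⟩

/-- `v` is an eigenvector of Euclidean norm one for the eigenvalue number `i` of `A`. -/
def IsUnitEigenvector {N : ℕ} {A : Matrix (Fin N) (Fin N) ℝ} (hA : A.IsHermitian)
    (i : ℕ) (hi : i < N) (v : Fin N → ℝ) : Prop :=
  v ⬝ᵥ v = 1 ∧ A *ᵥ v = orderedEigenvalue hA i hi • v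

/-- Growth of the signal strength: `√N (log N)^ξ ≼ θ_N ≼ N`, for an exponent
`ξ > max (4 (B + 1)) 8`. -/
structure GrowthCondition (B ξ : ℝ) (θ : ℕ → ℝ) : Prop where
  exponent : max (4 * (B + 1)) 8 < ξ
  lower : (fun N : ℕ => Real.sqrt N * Real.log N ^ ξ) =O[atTop] θ
  upper : θ =O[atTop] (fun N : ℕ => (N : ℝ))

/-- `h₁, …, h_k` are bounded on `[0,1]` and orthonormal in `L²[0,1]`. -/
structure OrthonormalSignals {k : ℕ} (h : Fin k → ℝ → ℝ) : Prop where
  bounded : ∀ i, ∃ M : ℝ, ∀ x ∈ Set.Icc (0 : ℝ) 1, |h i x| ≤ M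
  memLp : ∀ i, MemLp (h i) 2 (volume.restrict (Set.Icc (0 : ℝ) 1))
  orthonormal : ∀ i j, ∫ x in Set.Icc (0 : ℝ) 1, h i x * h j x = if i = j then 1 else 0

/-- Each `hᵢ` is Lipschitz continuous on `[0,1]`. -/
def LipschitzSignals {k : ℕ} (h : Fin k → ℝ → ℝ) : Prop :=
  ∀ i, ∃ L : ℝ, ∀ x ∈ Set.Icc (0 : ℝ) 1, ∀ y ∈ Set.Icc (0 : ℝ) 1, |h i x - h i y| ≤ L * |x - y|

/-- `E_N` occurs with high probability: `P(E_Nᶜ) = O(exp(-(log N)^η))` for some `η > 1`. -/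
def WithHighProb {Ω : ℕ → Type*} [∀ N, MeasurableSpace (Ω N)] (P : ∀ N, Measure (Ω N))
    (E : ∀ N, Set (Ω N)) : Prop :=
  ∃ η : ℝ, 1 < η ∧
    (fun N : ℕ => (P N).real (E N)ᶜ) =O[atTop] (fun N : ℕ => Real.exp (-(Real.log N ^ η)))

/-- `Y_N = O_hp(Z_N)`: for some constant `C > 0`, `|Y_N| ≤ C |Z_N|` with high probability. -/
def IsBigOhp {Ω : ℕ → Type*} [∀ N, MeasurableSpace (Ω N)] (P : ∀ N, Measure (Ω N))
    (Y Z : ∀ N, Ω N → ℝ) : Prop :=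
  ∃ C : ℝ, 0 < C ∧ WithHighProb P (fun N => {ω | |Y N ω| ≤ C * |Z N ω|})

/-- `Y_N = o_hp(Z_N)`: for every `δ > 0`, `|Y_N| ≤ δ |Z_N|` with high probability. -/
def IsLittleOhp {Ω : ℕ → Type*} [∀ N, MeasurableSpace (Ω N)] (P : ∀ N, Measure (Ω N))
    (Y Z : ∀ N, Ω N → ℝ) : Prop :=
  ∀ δ : ℝ, 0 < δ → WithHighProb P (fun N => {ω | |Y N ω| ≤ δ * |Z N ω|})

end

end SpikedWigner

open SpikedWigner

/-! With `y = θ ∑ α_l ⟨e_l, v⟩ e_l`, an eigenvector satisfies `λ v = W v + y`. Put `T = (log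
N)^(ξ/4)` and `R = √N T`. With high probability `‖W‖ ≤ R`, and `R/θ → 0`. A min-max argument
(`abs_eigenvalue_sub_le`) then gives `λ ≈ θ α_i`. Pairing the equation with `e_j` and using the gaps
between the `α`'s gives `⟨e_j, v⟩ = O(R/θ)` for `j ≠ i`, and the unit norm and the sign give `θ α_i
⟨e_i, v⟩ / λ = 1 + O(R/θ)`. Iterating the equation yields `v = ∑_{n ≤ m} λ^(-n-1) W^n y + λ^(-m-1)
W^(m+1) v`. In sup norm the term `n = 0` is `e_i` up to `O(N^(-1/2) R/θ)`. The later terms form a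
geometric series of the same order `N^(-1/2) R/θ = T/θ`, provided that the entries of `W^n e_l` are
`O(N^(-1/2) R^n)`. The operator norm alone would lose the factor `N^(-1/2)`. For `m ≈ log N` the
remainder is at most `1/N = O(1/θ)`. Both bounds on `W` come from one moment estimate,
`integral_pow_mulVec_apply_pow_le`. A high moment of an entry of `W^n u` is a sum over families of
walks with `L` steps in total. Only families that use no edge exactly once contribute, so about
`N^(L/2) L^L` remain, each of size at most `L^(BL)`. Markov's inequality with `L` of order `(log
N)^η`, `η > 1`, `η (B + 1) < ξ/4`, finishes the probabilistic part. -/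

/-! ### Moments of products of independent variables. -/

section Moments

variable {Ω E ι : Type*} [MeasurableSpace Ω] {P : Measure Ω} [Fintype ι] {Y : E → Ω → ℝ} {B : ℝ}

/-- Hölder's inequality, all exponents being the number of factors. -/
theorem integrable_prod_of_integrable_moments [IsProbabilityMeasure P]
    (hm : ∀ c, Measurable (Y c)) (hint : ∀ c, ∀ m : ℕ, 1 ≤ m → Integrable (fun ω => |Y c ω| ^ m) P)
    (e : ι → E) : Integrable (fun ω => ∏ i, Y (e i) ω) P := by
  rcases isEmpty_or_nonempty ι with hι | hι
  · simp
  have hc : Fintype.card ι ≠ 0 := Fintype.card_ne_zero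
  have h := MemLp.prod' (s := (Finset.univ : Finset ι)) (μ := P) (f := fun i => Y (e i))
    (p := fun _ => (Fintype.card ι : ENNReal)) (fun i _ => by
      have := hint (e i) (Fintype.card ι) (Nat.one_le_iff_ne_zero.2 hc)
      refine (integrable_norm_rpow_iff (hm _).aestronglyMeasurable (by exact_mod_cast hc)
        (ENNReal.natCast_ne_top _)).1 ?_
      simpa using this)
  rw [← memLp_one_iff_integrable]
  convert h using 1
  simp [ENNReal.mul_inv_cancel, hc]

variable [Fintype E] [DecidableEq E]

theorem integral_prod_eq_prod_fiber (hm : ∀ c, Measurable (Y c))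
    (hind : iIndepFun Y P) (e : ι → E) :
    ∫ ω, ∏ i, Y (e i) ω ∂P = ∏ c, ∫ ω, Y c ω ^ (Finset.univ.filter (fun i => e i = c)).card ∂P := by
  rw [← hind.integral_fun_prod_comp (f := fun c y => y ^ (Finset.univ.filter (fun i => e i = c)).card)
    (fun c => (hm c).aemeasurable) (fun c => (by fun_prop : Measurable _).aestronglyMeasurable)]
  congr 1 with ω
  rw [← Finset.prod_fiberwise' Finset.univ e (fun c => Y c ω)]
  simp

theorem integral_prod_eq_zero_of_card_fiber_eq_one (hm : ∀ c, Measurable (Y c))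
    (hind : iIndepFun Y P) (hmean : ∀ c, ∫ ω, Y c ω ∂P = 0) (e : ι → E) {c : E}
    (hc : (Finset.univ.filter (fun i => e i = c)).card = 1) :
    ∫ ω, ∏ i, Y (e i) ω ∂P = 0 := by
  rw [integral_prod_eq_prod_fiber hm hind]
  exact Finset.prod_eq_zero (Finset.mem_univ c) (by simp [hc, hmean])

/-- By independence each distinct variable contributes a moment of order `m`, its multiplicity.
Replacing `m ^ (B m)` by `(card ι) ^ (B m)` makes the exponents add up. -/
theorem abs_integral_prod_le [IsProbabilityMeasure P] (hB : 0 ≤ B) (hm : ∀ c, Measurable (Y c)) (hind : iIndepFun Y P)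
    (hmom : ∀ c, ∀ m : ℕ, 1 ≤ m → ∫ ω, |Y c ω| ^ m ∂P ≤ (m : ℝ) ^ (B * (m : ℝ))) (e : ι → E) :
    |∫ ω, ∏ i, Y (e i) ω ∂P| ≤ (Fintype.card ι : ℝ) ^ (B * (Fintype.card ι : ℝ)) := by
  rcases isEmpty_or_nonempty ι with hι | hι
  · simp
  have hpos : (0 : ℝ) < Fintype.card ι := by exact_mod_cast Fintype.card_pos
  rw [integral_prod_eq_prod_fiber hm hind, Finset.abs_prod]
  have hsum : ∑ c, (Finset.univ.filter (fun i => e i = c)).card = Fintype.card ι :=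
    (Finset.card_eq_sum_card_fiberwise (fun i _ => Finset.mem_univ (e i))).symm
  calc ∏ c, |∫ ω, Y c ω ^ (Finset.univ.filter (fun i => e i = c)).card ∂P|
      ≤ ∏ c, (Fintype.card ι : ℝ) ^ (B * ((Finset.univ.filter (fun i => e i = c)).card : ℝ)) := by
        refine Finset.prod_le_prod (fun _ _ => abs_nonneg _) (fun c _ => ?_)
        set m := (Finset.univ.filter (fun i => e i = c)).card with hmdef
        have hle : m ≤ Fintype.card ι := Finset.card_le_univ _
        rcases Nat.eq_zero_or_pos m with h0 | h0
        · simp [h0]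
        calc |∫ ω, Y c ω ^ m ∂P| ≤ ∫ ω, |Y c ω ^ m| ∂P := abs_integral_le_integral_abs
          _ = ∫ ω, |Y c ω| ^ m ∂P := by simp [abs_pow]
          _ ≤ (m : ℝ) ^ (B * (m : ℝ)) := hmom c m h0
          _ ≤ _ := by
            apply Real.rpow_le_rpow (by positivity) (by exact_mod_cast hle) (by positivity)
    _ = _ := by
        rw [← Real.rpow_sum_of_pos hpos, ← Finset.mul_sum]
        congr 2
        exact_mod_cast hsum

end Moments

/-! ### Counting walks by their vertices and edges. -/

section Counting

/-- Functions taking few values different from `a` are few. -/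
theorem card_filter_image_erase_le {ι α : Type*} [Fintype ι] [DecidableEq ι] [Fintype α]
    [DecidableEq α] (a : α) (r : ℕ) :
    (Finset.univ.filter (fun x : ι → α => ((Finset.univ.image x).erase a).card ≤ r)).card
      ≤ Fintype.card α ^ r * (r + 1) ^ Fintype.card ι := by
  -- A function is encoded by a list of `r` values and, at each point, either a position in the list
  -- or `none`, which stands for `a`.
  let F : (Fin r → α) × (ι → Option (Fin r)) → ι → α :=
    fun z i => (z.2 i).elim a z.1
  have hsub : Finset.univ.filter (fun x : ι → α => ((Finset.univ.image x).erase a).card ≤ r)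
      ⊆ Finset.univ.image F := by
    intro x hx
    simp only [Finset.mem_filter, Finset.mem_univ, true_and] at hx
    set s := (Finset.univ.image x).erase a with hs
    have g := s.equivFin
    let y : Fin r → α := fun j => if h : (j : ℕ) < s.card then (g.symm ⟨j, h⟩ : α) else a
    refine Finset.mem_image.2 ⟨(y, fun i => if h : x i ∈ s then
      some ⟨g ⟨x i, h⟩, (g ⟨x i, h⟩).2.trans_le hx⟩ else none), Finset.mem_univ _, ?_⟩
    funext i
    by_cases h : x i ∈ s
    · simp [F, h, y]
    · have : x i = a := by
        by_contra hne
        exact h (Finset.mem_erase.2 ⟨hne, Finset.mem_image_of_mem _ (Finset.mem_univ _)⟩)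
      have ha : a ∉ s := this ▸ h
      simp [F, this, ha]
  refine (Finset.card_le_card hsub).trans (Finset.card_image_le.trans ?_)
  simp

/-- In a rooted family of walks, where each vertex `x i` is joined to an earlier vertex or to the
root, there are at least as many edges as vertices different from the root. -/
theorem card_vertices_erase_le_card_edges {ι α β : Type*} [Fintype ι] [LinearOrder ι]
    [DecidableEq α] [DecidableEq β] (a : α) (x y : ι → α) (edge : α → α → β)
    (hedge : ∀ u v w z, edge u v = edge w z → (u = w ∧ v = z) ∨ (u = z ∧ v = w))
    (hy : ∀ i, y i = a ∨ ∃ j < i, y i = x j) :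
    ((Finset.univ.image x).erase a).card ≤ (Finset.univ.image fun i => edge (y i) (x i)).card := by
  rcases isEmpty_or_nonempty ι with hι | hι
  · simp
  -- Each vertex `v ≠ a` is sent to the edge along which it is first reached; this map is shown to
  -- be injective.
  have hfirst : ∀ v ∈ (Finset.univ.image x).erase a, ∃ i, x i = v ∧ ∀ j < i, x j ≠ v := by
    intro v hv
    obtain ⟨i, -, hi⟩ := Finset.mem_image.1 (Finset.mem_of_mem_erase hv)
    have hne : (Finset.univ.filter (fun i => x i = v)).Nonempty := ⟨i, by simp [hi]⟩
    refine ⟨(Finset.univ.filter (fun i => x i = v)).min' hne, ?_, fun j hj hjv => ?_⟩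
    · simpa using Finset.min'_mem _ hne
    · exact absurd (Finset.min'_le _ j (by simp [hjv])) (not_le.2 hj)
  choose! t ht hmin using hfirst
  refine Finset.card_le_card_of_injOn (fun v => edge (y (t v)) (x (t v))) (fun v _ =>
    Finset.mem_coe.2 (Finset.mem_image_of_mem (fun i => edge (y i) (x i)) (Finset.mem_univ _))) ?_
  intro v hv w hw hvw
  rcases hedge _ _ _ _ hvw with ⟨-, h⟩ | ⟨h1, h2⟩
  · rwa [ht v hv, ht w hw] at h
  -- The same edge in opposite directions: `v` would be first reached from `w` and `w` from `v`, so
  -- each would be visited strictly before the other.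
  · exfalso
    rw [ht w hw] at h1
    rw [ht v hv] at h2
    have hva := (Finset.mem_erase.1 hv).1
    have hwa := (Finset.mem_erase.1 hw).1
    rcases hy (t v) with h | ⟨j, hj, h⟩
    · exact hwa (h1.symm.trans h)
    rcases hy (t w) with h' | ⟨j', hj', h'⟩
    · exact hva (h2.trans h')
    have a1 : t w ≤ j := not_lt.1 fun hlt => hmin w hw j hlt (h.symm.trans h1)
    have a2 : t v ≤ j' := not_lt.1 fun hlt => hmin v hv j' hlt (h'.symm.trans h2.symm)
    exact absurd (a1.trans_lt (hj.trans_le (a2.trans hj'.le))) (lt_irrefl _)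

end Counting

/-! ### Matrix powers as sums over walks. -/

section Expansion

/-- The vertex preceding the `s`-th one in the walk `a, x 0, x 1, …`. -/
def walkPrev {α : Type*} (a : α) {n : ℕ} (x : Fin n → α) (s : Fin n) : α :=
  (Fin.cons a x : Fin (n + 1) → α) s.castSucc

theorem pow_mulVec_apply {N : ℕ} (W : Matrix (Fin N) (Fin N) ℝ) (u : Fin N → ℝ) (n : ℕ)
    (a : Fin N) :
    (W ^ n *ᵥ u) a = ∑ x : Fin n → Fin N, (∏ s, W (walkPrev a x s) (x s)) *
      u ((Fin.cons a x : Fin (n + 1) → Fin N) (Fin.last n)) := by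
  induction n generalizing a with
  | zero => simp
  | succ n ih =>
    have hcons (F : (Fin (n + 1) → Fin N) → ℝ) : ∑ x, F x = ∑ b, ∑ x, F (Fin.cons b x) := by
      rw [← (Fin.consEquiv (fun _ => Fin N)).sum_comp, Fintype.sum_prod_type]
      rfl
    rw [pow_succ', ← Matrix.mulVec_mulVec, hcons]
    change ∑ b, W a b * (W ^ n *ᵥ u) b = _
    refine Finset.sum_congr rfl fun b _ => ?_
    rw [ih, Finset.mul_sum]
    refine Finset.sum_congr rfl fun x _ => ?_
    rw [Fin.prod_univ_succ, ← mul_assoc]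
    rfl

end Expansion

/-! ### The moment estimate for entries of `W ^ n *ᵥ u`. -/

section WalkMoments

/-- The unordered pair `{a, b}`, as a position in the upper triangle. -/
def upperEdge {N : ℕ} (a b : Fin N) : {p : Fin N × Fin N // p.1 ≤ p.2} :=
  ⟨(min a b, max a b), min_le_max⟩

theorem upperEdge_eq_iff {N : ℕ} (u v w z : Fin N) (h : upperEdge u v = upperEdge w z) :
    (u = w ∧ v = z) ∨ (u = z ∧ v = w) := by
  simp only [upperEdge, Subtype.mk.injEq, Prod.mk.injEq] at h
  obtain ⟨h1, h2⟩ := h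
  rcases le_total u v with h3 | h3 <;> rcases le_total w z with h4 | h4 <;>
    simp only [h3, h4, min_eq_left, min_eq_right, max_eq_left, max_eq_right] at h1 h2 <;> tauto

/-- The edges of the `p` walks of length `n` starting at `a` with vertices `x`. -/
def walkEdge {N p n : ℕ} (a : Fin N) (x : Fin p × Fin n → Fin N) (i : Fin p × Fin n) :
    {p : Fin N × Fin N // p.1 ≤ p.2} :=
  upperEdge (walkPrev a (fun s => x (i.1, s)) i.2) (x i)

theorem walkPrev_eq {α : Type*} (a : α) {n : ℕ} (x : Fin n → α) (s : Fin n) :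
    walkPrev a x s = a ∨ ∃ t < s, walkPrev a x s = x t := by
  obtain ⟨n, rfl⟩ : ∃ m, n = m + 1 := ⟨n - 1, by have := s.2; omega⟩
  induction s using Fin.cases with
  | zero => left; simp [walkPrev]
  | succ t =>
    right
    exact ⟨t.castSucc, Fin.castSucc_lt_succ, by simp [walkPrev]⟩

/-- The `p n` steps use every occurring edge at least twice, hence at most `p n / 2` edges, and
these are at least as many as the vertices other than the root. -/
theorem card_vertices_le_of_two_le_card_fiber {N p n : ℕ} (a : Fin N) (x : Fin p × Fin n → Fin N)
    (h : ∀ c, (Finset.univ.filter (fun i => walkEdge a x i = c)).card ≠ 1) :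
    ((Finset.univ.image x).erase a).card ≤ p * n / 2 := by
  have h1 : ((Finset.univ.image x).erase a).card ≤ (Finset.univ.image (walkEdge a x)).card := by
    -- The lexicographic order runs through the walks one after the other, each restarting at `a`,
    -- so each step leaves the root or a vertex already visited.
    refine card_vertices_erase_le_card_edges (ι := Fin p ×ₗ Fin n) a (fun i => x (ofLex i))
      (fun i => walkPrev a (fun s => x ((ofLex i).1, s)) (ofLex i).2) upperEdge upperEdge_eq_iff ?_
    intro i
    rcases walkPrev_eq a (fun s => x ((ofLex i).1, s)) (ofLex i).2 with h | ⟨t, ht, h⟩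
    · exact Or.inl h
    · exact Or.inr ⟨toLex ((ofLex i).1, t), Prod.Lex.lt_iff.2 (Or.inr ⟨rfl, ht⟩), h⟩
  have h2 := Finset.mul_card_image_le_card (f := walkEdge a x) (Finset.univ) 2 (fun c hc => by
    obtain ⟨i, hi, hic⟩ := Finset.mem_image.1 hc
    have h0 : (Finset.univ.filter (fun i => walkEdge a x i = c)).card ≠ 0 :=
      Finset.card_ne_zero.2 ⟨i, by simp [hic]⟩
    have := h c
    omega)
  simp only [Finset.card_univ, Fintype.card_prod, Fintype.card_fin] at h2
  omega

variable {Ω : Type*} {N : ℕ}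

theorem pow_mulVec_apply_pow (X : Fin N → Fin N → Ω → ℝ) (ω : Ω) (u : Fin N → ℝ)
    (n p : ℕ) (a : Fin N) :
    ((wignerMatrix X ω ^ n *ᵥ u) a) ^ p = ∑ x : Fin p × Fin n → Fin N,
      (∏ i, X (walkEdge a x i).1.1 (walkEdge a x i).1.2 ω) *
        ∏ q, u ((Fin.cons a (fun s => x (q, s)) : Fin (n + 1) → Fin N) (Fin.last n)) := by
  rw [pow_mulVec_apply, Fintype.sum_pow, ← (Equiv.curry _ _ _).sum_comp]
  refine Finset.sum_congr rfl fun x _ => ?_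
  rw [Finset.prod_mul_distrib, Fintype.prod_prod_type]
  rfl

variable [MeasurableSpace Ω] {P : Measure Ω} [IsProbabilityMeasure P]
  {f : ℝ → ℝ → ℝ} {B : ℝ} {X : Fin N → Fin N → Ω → ℝ}

theorem integrable_pow_mulVec_apply_pow (hX : IsWignerArray P f B X) (u : Fin N → ℝ) (n p : ℕ)
    (a : Fin N) : Integrable (fun ω => ((wignerMatrix X ω ^ n *ᵥ u) a) ^ p) P := by
  simp_rw [pow_mulVec_apply_pow]
  refine integrable_finsetSum _ fun x _ => Integrable.mul_const ?_ _
  exact integrable_prod_of_integrable_moments (Y := fun (c : {p : Fin N × Fin N // p.1 ≤ p.2}) =>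
    X c.1.1 c.1.2) (fun c => hX.measurable _ _ c.2) (fun c => hX.integrable_moment _ _ c.2) _

/-- The factor `√N` per step reflects that surviving families have at most `L / 2` free vertices. In
`L ^ (B + 1)`, one power counts the patterns and `B` powers come from the moments. -/
theorem integral_pow_mulVec_apply_pow_le (hB : 0 ≤ B) (hX : IsWignerArray P f B X)
    (u : Fin N → ℝ) (hu : ∀ j, |u j| ≤ 1) (n p : ℕ) (hL : 2 ≤ p * n) (a : Fin N) :
    ∫ ω, ((wignerMatrix X ω ^ n *ᵥ u) a) ^ p ∂P ≤
      (Real.sqrt N * ((p * n : ℕ) : ℝ) ^ (B + 1)) ^ (p * n) := by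
  have hN : (1 : ℝ) ≤ N := by exact_mod_cast (Nat.one_le_iff_ne_zero.2 (by rintro rfl; exact a.elim0))
  have hint (x : Fin p × Fin n → Fin N) :=
    integrable_prod_of_integrable_moments (Y := fun (c : {p : Fin N × Fin N // p.1 ≤ p.2}) =>
      X c.1.1 c.1.2) (fun c => hX.measurable _ _ c.2) (fun c => hX.integrable_moment _ _ c.2)
      (walkEdge a x)
  simp_rw [pow_mulVec_apply_pow]
  rw [integral_finsetSum _ fun x _ => (hint x).mul_const _]
  simp_rw [integral_mul_const]
  set L := p * n with hLdef
  have hLpos : (0 : ℝ) < L := by exact_mod_cast (by omega : 0 < L)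
  let S := Finset.univ.filter (fun x : Fin p × Fin n → Fin N =>
    ((Finset.univ.image x).erase a).card ≤ L / 2)
  calc _ ≤ ∑ x ∈ S, (L : ℝ) ^ (B * (L : ℝ)) := by
        rw [Finset.sum_filter]
        refine Finset.sum_le_sum fun x _ => ?_
        split_ifs with hx
        · refine (le_abs_self _).trans ?_
          rw [abs_mul, Finset.abs_prod, ← mul_one ((L : ℝ) ^ (B * (L : ℝ)))]
          refine mul_le_mul ?_ (Finset.prod_le_one (fun _ _ => abs_nonneg _) fun _ _ => hu _)
            (Finset.prod_nonneg fun _ _ => abs_nonneg _) (by positivity)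
          have := abs_integral_prod_le (Y := fun (c : {p : Fin N × Fin N // p.1 ≤ p.2}) =>
            X c.1.1 c.1.2) hB (fun c => hX.measurable _ _ c.2) hX.indep
            (fun c => hX.moment_le _ _ c.2) (walkEdge a x)
          simpa [hLdef] using this
        -- Too many vertices force an edge used exactly once, and its centred entry annihilates the
        -- expectation.
        · have : ∃ c, (Finset.univ.filter (fun i => walkEdge a x i = c)).card = 1 := by
            by_contra! hcon
            exact hx (card_vertices_le_of_two_le_card_fiber a x hcon)
          obtain ⟨c, hc⟩ := this
          rw [integral_prod_eq_zero_of_card_fiber_eq_one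
            (Y := fun (c : {p : Fin N × Fin N // p.1 ≤ p.2}) => X c.1.1 c.1.2)
            (fun c => hX.measurable _ _ c.2) hX.indep (fun c => hX.mean _ _ c.2) _ hc, zero_mul]
    _ = (S.card : ℝ) * (L : ℝ) ^ (B * (L : ℝ)) := by rw [Finset.sum_const, nsmul_eq_mul]
    _ ≤ (N : ℝ) ^ (L / 2) * (L : ℝ) ^ L * (L : ℝ) ^ (B * (L : ℝ)) := by
        gcongr
        have := card_filter_image_erase_le (ι := Fin p × Fin n) a (L / 2)
        simp only [Fintype.card_prod, Fintype.card_fin, ← hLdef] at this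
        calc (S.card : ℝ) ≤ ((N ^ (L / 2) * (L / 2 + 1) ^ L : ℕ) : ℝ) := by exact_mod_cast this
          _ ≤ ((N ^ (L / 2) * L ^ L : ℕ) : ℝ) := by
            gcongr
            -- `L / 2 + 1 ≤ L` because `L ≥ 2`.
            omega
          _ = _ := by push_cast; ring
    _ ≤ Real.sqrt N ^ L * (L : ℝ) ^ L * (L : ℝ) ^ (B * (L : ℝ)) := by
        gcongr
        calc (N : ℝ) ^ (L / 2) = Real.sqrt N ^ (2 * (L / 2)) := by
              rw [pow_mul, Real.sq_sqrt (by positivity)]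
          _ ≤ _ := pow_le_pow_right₀ (Real.one_le_sqrt.2 hN) (by omega)
    _ = _ := by
        rw [mul_pow, ← Real.rpow_mul_natCast hLpos.le, mul_assoc, ← Real.rpow_natCast (L : ℝ) L,
          ← Real.rpow_add hLpos]
        ring_nf

end WalkMoments

/-! ### Markov bounds for the entries of `W ^ n *ᵥ u` and for the norm of `W`. -/

section Tails

theorem trace_pow_two_mul {N : ℕ} {W : Matrix (Fin N) (Fin N) ℝ} (hW : W.IsHermitian) (m : ℕ) :
    (W ^ (2 * m)).trace = ∑ a, ∑ b, (W ^ m) a b ^ 2 := by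
  have hsym : (W ^ m)ᵀ = W ^ m := by
    rw [Matrix.transpose_pow]; congr 1
  rw [two_mul, pow_add]
  nth_rewrite 2 [← hsym]
  simp only [Matrix.trace, Matrix.diag_apply, Matrix.mul_apply, Matrix.transpose_apply, sq]

/-- The trace is the squared Frobenius norm of `W ^ m`; Cauchy–Schwarz is applied row by row. -/
theorem sum_sq_mulVec_le {N : ℕ} {W : Matrix (Fin N) (Fin N) ℝ} (hW : W.IsHermitian) (m : ℕ)
    (w : Fin N → ℝ) :
    ∑ a, ((W ^ m *ᵥ w) a) ^ 2 ≤ (W ^ (2 * m)).trace * ∑ b, w b ^ 2 := by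
  rw [trace_pow_two_mul hW, Finset.sum_mul]
  exact Finset.sum_le_sum fun a _ =>
    Finset.sum_mul_sq_le_sq_mul_sq Finset.univ (fun b => (W ^ m) a b) w

/-- Testing `sum_sq_mulVec_le` on an eigenvector bounds its eigenvalue by `K` in absolute value; the
spectral decomposition does the rest. -/
theorem norm_toEuclideanLin_le_of_trace_le {N : ℕ} (W : Matrix (Fin N) (Fin N) ℝ)
    (hW : W.IsHermitian) {m : ℕ} (hm : m ≠ 0) {K : ℝ} (hK : 0 ≤ K)
    (htr : (W ^ (2 * m)).trace ≤ K ^ (2 * m)) (x : EuclideanSpace ℝ (Fin N)) :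
    ‖Matrix.toEuclideanLin W x‖ ≤ K * ‖x‖ := by
  have hsym := Matrix.isSymmetric_toEuclideanLin_iff.mpr hW
  have hfin : Module.finrank ℝ (EuclideanSpace ℝ (Fin N)) = N := by simp
  set b := hsym.eigenvectorBasis hfin with hb
  set μ := hsym.eigenvalues hfin with hμ
  have happ (i : Fin N) : W *ᵥ (b i).ofLp = μ i • (b i).ofLp := by
    have := hsym.apply_eigenvectorBasis hfin i
    exact congrArg WithLp.ofLp this
  have hpow (i : Fin N) (n : ℕ) : W ^ n *ᵥ (b i).ofLp = μ i ^ n • (b i).ofLp := by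
    induction n with
    | zero => simp
    | succ n ih => rw [pow_succ, ← Matrix.mulVec_mulVec, happ, Matrix.mulVec_smul, ih, smul_smul,
        pow_succ']
  have hbound (i : Fin N) : μ i ^ 2 ≤ K ^ 2 := by
    have h1 := sum_sq_mulVec_le hW m (b i).ofLp
    have hone : ∑ j, (b i).ofLp j ^ 2 = 1 := by
      have := EuclideanSpace.real_norm_sq_eq (b i)
      rw [b.norm_eq_one] at this
      linarith
    rw [hpow, hone] at h1
    simp only [Pi.smul_apply, smul_eq_mul, mul_pow, ← Finset.mul_sum, hone, mul_one] at h1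
    rw [← pow_mul, mul_comm m 2] at h1
    have h2 : (μ i ^ 2) ^ m ≤ (K ^ 2) ^ m := by
      rw [← pow_mul, ← pow_mul]; exact h1.trans htr
    exact le_of_pow_le_pow_left₀ hm (by positivity) h2
  have hsq : ‖Matrix.toEuclideanLin W x‖ ^ 2 ≤ (K * ‖x‖) ^ 2 := by
    rw [← b.sum_sq_norm_inner_right, mul_pow, ← b.sum_sq_norm_inner_right x, Finset.mul_sum]
    refine Finset.sum_le_sum fun i _ => ?_
    rw [← hsym, hsym.apply_eigenvectorBasis hfin i, inner_smul_left, norm_mul, mul_pow]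
    gcongr
    exact abs_le_of_sq_le_sq (hbound i) hK
  exact le_of_sq_le_sq hsq (by positivity)

variable {Ω : Type*} {N : ℕ} [MeasurableSpace Ω] {P : Measure Ω} [IsProbabilityMeasure P]
  {f : ℝ → ℝ → ℝ} {B : ℝ} {X : Fin N → Fin N → Ω → ℝ}

theorem wignerMatrix_isHermitian {Ω : Type*} {N : ℕ} (X : Fin N → Fin N → Ω → ℝ) (ω : Ω) :
    (wignerMatrix X ω).IsHermitian := by
  ext j l
  simp [wignerMatrix, min_comm, max_comm]

theorem measure_pow_mulVec_apply_gt_le (hB : 0 ≤ B) (hX : IsWignerArray P f B X)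
    (u : Fin N → ℝ) (hu : ∀ j, |u j| ≤ 1) {n p : ℕ} (hp : Even p) (hL : 2 ≤ p * n) (a : Fin N)
    {Q : ℝ} (hQ : 0 < Q) :
    P.real {ω | (Real.sqrt N * Q) ^ n < |(wignerMatrix X ω ^ n *ᵥ u) a|} ≤
      (((p * n : ℕ) : ℝ) ^ (B + 1) / Q) ^ (p * n) := by
  have hN : (0 : ℝ) < N := by exact_mod_cast (Nat.pos_of_ne_zero (by rintro rfl; exact a.elim0))
  have hp0 : p ≠ 0 := by rintro rfl; simp at hL
  have hR : 0 < (Real.sqrt N * Q) ^ (p * n) := by positivity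
  have h1 := mul_meas_ge_le_integral_of_nonneg (μ := P)
    (f := fun ω => ((wignerMatrix X ω ^ n *ᵥ u) a) ^ p)
    (Eventually.of_forall fun ω => hp.pow_nonneg _) (integrable_pow_mulVec_apply_pow hX u n p a)
    ((Real.sqrt N * Q) ^ (p * n))
  have h2 := h1.trans (integral_pow_mulVec_apply_pow_le hB hX u hu n p hL a)
  calc _ ≤ P.real {ω | (Real.sqrt N * Q) ^ (p * n) ≤ ((wignerMatrix X ω ^ n *ᵥ u) a) ^ p} := by
        refine measureReal_mono fun ω hω => ?_
        simp only [Set.mem_ofPred_eq] at hω ⊢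
        rw [← hp.pow_abs, mul_comm p n, pow_mul]
        exact pow_le_pow_left₀ (by positivity) hω.le p
    _ ≤ (Real.sqrt N * ((p * n : ℕ) : ℝ) ^ (B + 1)) ^ (p * n) / (Real.sqrt N * Q) ^ (p * n) := by
        rw [le_div_iff₀ hR, mul_comm]
        exact h2
    _ = _ := by
        rw [← div_pow, mul_div_mul_left _ _ (by positivity)]

theorem measure_not_norm_le_le (hB : 0 ≤ B) (hX : IsWignerArray P f B X) {m : ℕ} (hm : m ≠ 0)
    {Q : ℝ} (hQ : 0 < Q) :
    P.real {ω | ¬ ∀ x, ‖Matrix.toEuclideanLin (wignerMatrix X ω) x‖ ≤ Real.sqrt N * Q * ‖x‖} ≤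
      N * (((2 * m : ℕ) : ℝ) ^ (B + 1) / Q) ^ (2 * m) := by
  rcases Nat.eq_zero_or_pos N with rfl | hN
  · simp [Subsingleton.elim _ (0 : EuclideanSpace ℝ (Fin 0))]
  have hN' : (0 : ℝ) < N := by exact_mod_cast hN
  have hR : 0 < (Real.sqrt N * Q) ^ (2 * m) := by positivity
  -- A diagonal entry of `W ^ (2 * m)` is the case `p = 1` with `u` a basis vector, so the walk
  -- estimate also bounds the trace.
  have htr (ω : Ω) : (wignerMatrix X ω ^ (2 * m)).trace =
      ∑ a, ((wignerMatrix X ω ^ (2 * m) *ᵥ (Pi.single a 1)) a) ^ 1 := by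
    simp [Matrix.trace]
  have hu (a j : Fin N) : |(Pi.single a 1 : Fin N → ℝ) j| ≤ 1 := by
    by_cases h : j = a <;> simp [h]
  have hint (a : Fin N) := integrable_pow_mulVec_apply_pow hX (Pi.single a 1) (2 * m) 1 a
  have hE : ∫ ω, (wignerMatrix X ω ^ (2 * m)).trace ∂P ≤
      N * (Real.sqrt N * ((2 * m : ℕ) : ℝ) ^ (B + 1)) ^ (2 * m) := by
    simp_rw [htr]
    rw [integral_finsetSum _ fun a _ => hint a]
    calc _ ≤ ∑ a : Fin N, (Real.sqrt N * ((2 * m : ℕ) : ℝ) ^ (B + 1)) ^ (2 * m) := by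
          refine Finset.sum_le_sum fun a _ => ?_
          have := integral_pow_mulVec_apply_pow_le hB hX (Pi.single a 1) (hu a) (2 * m) 1
            (by omega) a
          rwa [one_mul] at this
      _ = _ := by simp
  have hnn (ω : Ω) : 0 ≤ (wignerMatrix X ω ^ (2 * m)).trace := by
    rw [trace_pow_two_mul (wignerMatrix_isHermitian X ω)]
    exact Finset.sum_nonneg fun _ _ => Finset.sum_nonneg fun _ _ => sq_nonneg _
  have h1 := mul_meas_ge_le_integral_of_nonneg (μ := P)
    (f := fun ω => (wignerMatrix X ω ^ (2 * m)).trace)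
    (Eventually.of_forall hnn) (by simp_rw [htr]; exact integrable_finsetSum _ fun a _ => hint a)
    ((Real.sqrt N * Q) ^ (2 * m))
  calc _ ≤ P.real {ω | (Real.sqrt N * Q) ^ (2 * m) ≤ (wignerMatrix X ω ^ (2 * m)).trace} := by
        refine measureReal_mono fun ω hω => ?_
        simp only [Set.mem_ofPred_eq] at hω ⊢
        by_contra! hcon
        exact hω (norm_toEuclideanLin_le_of_trace_le _ (wignerMatrix_isHermitian X ω) hm
          (by positivity) hcon.le)
    _ ≤ N * (Real.sqrt N * ((2 * m : ℕ) : ℝ) ^ (B + 1)) ^ (2 * m) /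
        (Real.sqrt N * Q) ^ (2 * m) := by
        rw [le_div_iff₀ hR, mul_comm]
        exact h1.trans hE
    _ = _ := by
        rw [mul_div_assoc, ← div_pow, mul_div_mul_left _ _ (by positivity)]

end Tails

/-! ### Min-max location of the spiked eigenvalues. -/

section Spectral

open scoped InnerProductSpace

variable {E : Type*} [NormedAddCommGroup E] [InnerProductSpace ℝ E]

/-- There are fewer linear conditions than unknown coefficients. It supplies the test vectors for
both halves of the min-max argument, with eigenvectors and signals exchanging roles. -/
theorem exists_ne_zero_forall_inner_eq_zero {ι κ : Type*} [Fintype ι] [DecidableEq ι]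
    (p : ι → E) (q : κ → E) (s : Finset ι) (t : Finset κ) (hst : t.card < s.card) :
    ∃ a : ι → ℝ, a ≠ 0 ∧ (∀ l ∉ s, a l = 0) ∧ ∀ j ∈ t, ⟪q j, ∑ l, a l • p l⟫_ℝ = 0 := by
  let F : (s → ℝ) →ₗ[ℝ] (t → ℝ) := LinearMap.pi fun j =>
    (innerₛₗ ℝ (q j)).comp (Fintype.linearCombination ℝ (fun l : s => p l))
  have hker : F.ker ≠ ⊥ := LinearMap.ker_ne_bot_of_finrank_lt (by simpa using hst)
  obtain ⟨a, ha, ha0⟩ := F.ker.ne_bot_iff.1 hker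
  refine ⟨fun l => if h : l ∈ s then a ⟨l, h⟩ else 0, ?_, fun l hl => by simp [hl], ?_⟩
  · intro h
    refine ha0 (funext fun l => ?_)
    have := congrFun h l
    simpa using this
  · intro j hj
    have h1 : F a ⟨j, hj⟩ = 0 := by rw [LinearMap.mem_ker.1 ha]; rfl
    have h2 : ∑ l, (if h : l ∈ s then a ⟨l, h⟩ else 0) • p l = ∑ l : s, a l • p l := by
      rw [← Finset.sum_subset (Finset.subset_univ s) (fun l _ hl => by simp [hl]),
        ← Finset.sum_coe_sort s]
      exact Finset.sum_congr rfl fun l _ => by simp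
    rw [h2]
    simpa [F, Fintype.linearCombination_apply] using h1

theorem inner_apply_eq_sum_eigenvalues [FiniteDimensional ℝ E] {n : ℕ} {T : E →ₗ[ℝ] E}
    (hT : T.IsSymmetric) (hn : Module.finrank ℝ E = n) (x : E) :
    ⟪T x, x⟫_ℝ = ∑ j, hT.eigenvalues hn j * ⟪hT.eigenvectorBasis hn j, x⟫_ℝ ^ 2 := by
  rw [← (hT.eigenvectorBasis hn).sum_inner_mul_inner (T x) x]
  refine Finset.sum_congr rfl fun j _ => ?_
  rw [hT, hT.apply_eigenvectorBasis hn, inner_smul_right, real_inner_comm]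
  simp only [RCLike.ofReal_real_eq_id, id_eq]
  ring

theorem inner_apply_le_eigenvalue_mul [FiniteDimensional ℝ E] {n : ℕ} {T : E →ₗ[ℝ] E}
    (hT : T.IsSymmetric) (hn : Module.finrank ℝ E = n) (i : Fin n) (x : E)
    (hx : ∀ j < i, ⟪hT.eigenvectorBasis hn j, x⟫_ℝ = 0) :
    ⟪T x, x⟫_ℝ ≤ hT.eigenvalues hn i * ‖x‖ ^ 2 := by
  rw [inner_apply_eq_sum_eigenvalues hT hn, ← (hT.eigenvectorBasis hn).sum_sq_norm_inner_right x,
    Finset.mul_sum]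
  refine Finset.sum_le_sum fun j _ => ?_
  rcases lt_or_ge j i with h | h
  · simp [hx j h]
  · rw [Real.norm_eq_abs, sq_abs]
    exact mul_le_mul_of_nonneg_right (hT.eigenvalues_antitone hn h) (sq_nonneg _)

theorem eigenvalue_mul_le_inner_apply [FiniteDimensional ℝ E] {n : ℕ} {T : E →ₗ[ℝ] E}
    (hT : T.IsSymmetric) (hn : Module.finrank ℝ E = n) (i : Fin n) (x : E)
    (hx : ∀ j, i < j → ⟪hT.eigenvectorBasis hn j, x⟫_ℝ = 0) :
    hT.eigenvalues hn i * ‖x‖ ^ 2 ≤ ⟪T x, x⟫_ℝ := by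
  rw [inner_apply_eq_sum_eigenvalues hT hn, ← (hT.eigenvectorBasis hn).sum_sq_norm_inner_right x,
    Finset.mul_sum]
  refine Finset.sum_le_sum fun j _ => ?_
  rcases lt_or_ge i j with h | h
  · simp [hx j h]
  · rw [Real.norm_eq_abs, sq_abs]
    exact mul_le_mul_of_nonneg_right (hT.eigenvalues_antitone hn h) (sq_nonneg _)

section Gram

variable {k : ℕ} {e : Fin k → E} {g : ℝ}

/-- The Gram error is a quadratic form bounded by `g (∑ |a l|)²`, and Cauchy–Schwarz costs the
factor `k`. -/
theorem abs_norm_sq_sum_sub_le (hg : 0 ≤ g)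
    (hgram : ∀ j l, |⟪e j, e l⟫_ℝ - if j = l then 1 else 0| ≤ g) (a : Fin k → ℝ) :
    |‖∑ l, a l • e l‖ ^ 2 - ∑ l, a l ^ 2| ≤ k * g * ∑ l, a l ^ 2 := by
  have h1 : ‖∑ l, a l • e l‖ ^ 2 - ∑ l, a l ^ 2 =
      ∑ j, ∑ l, a j * a l * (⟪e j, e l⟫_ℝ - if j = l then 1 else 0) := by
    rw [← real_inner_self_eq_norm_sq, sum_inner]
    simp_rw [inner_sum, inner_smul_left, inner_smul_right, mul_sub, Finset.sum_sub_distrib]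
    congr 1
    · exact Finset.sum_congr rfl fun _ _ => Finset.sum_congr rfl fun _ _ => by simp; ring
    · simp [sq]
  rw [h1]
  calc _ ≤ ∑ j, ∑ l, |a j| * |a l| * g := by
        refine (Finset.abs_sum_le_sum_abs _ _).trans (Finset.sum_le_sum fun j _ => ?_)
        refine (Finset.abs_sum_le_sum_abs _ _).trans (Finset.sum_le_sum fun l _ => ?_)
        rw [abs_mul, abs_mul]
        exact mul_le_mul_of_nonneg_left (hgram j l) (by positivity)
    _ = g * (∑ j, |a j|) ^ 2 := by
        rw [sq, Finset.sum_mul_sum, Finset.mul_sum]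
        refine Finset.sum_congr rfl fun j _ => ?_
        rw [Finset.mul_sum]
        exact Finset.sum_congr rfl fun l _ => by ring
    _ ≤ g * (k * ∑ l, a l ^ 2) := by
        gcongr
        have := sq_sum_le_card_mul_sum_sq (s := (Finset.univ : Finset (Fin k))) (f := fun j => |a j|)
        simpa using this
    _ = _ := by ring

/-- Bessel's inequality for an almost orthonormal family, dual to `abs_norm_sq_sum_sub_le`: pair `x`
with `∑ ⟪e l, x⟫ e l`. -/
theorem sum_inner_sq_le (hg : 0 ≤ g)
    (hgram : ∀ j l, |⟪e j, e l⟫_ℝ - if j = l then 1 else 0| ≤ g) (x : E) :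
    ∑ l, ⟪e l, x⟫_ℝ ^ 2 ≤ (1 + k * g) * ‖x‖ ^ 2 := by
  set q := ∑ l, ⟪e l, x⟫_ℝ ^ 2 with hq
  have hq0 : 0 ≤ q := Finset.sum_nonneg fun _ _ => sq_nonneg _
  set y := ∑ l, ⟪e l, x⟫_ℝ • e l with hy
  have h1 : ⟪y, x⟫_ℝ = q := by
    rw [hy, sum_inner, hq]
    exact Finset.sum_congr rfl fun l _ => by rw [inner_smul_left]; simp [sq]
  have h2 := (abs_le.1 (abs_norm_sq_sum_sub_le hg hgram (fun l => ⟪e l, x⟫_ℝ))).2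
  rw [← hy, ← hq] at h2
  have h3 : q ^ 2 ≤ ‖y‖ ^ 2 * ‖x‖ ^ 2 := by
    rw [← mul_pow, ← h1, ← sq_abs]
    exact pow_le_pow_left₀ (abs_nonneg _) (abs_real_inner_le_norm y x) 2
  rcases hq0.eq_or_lt with h0 | h0
  · rw [← h0]; positivity
  · refine le_of_mul_le_mul_left ?_ h0
    nlinarith [sq_nonneg ‖x‖]

/-- Location of the top eigenvalues of a spiked operator. -/
theorem abs_eigenvalue_sub_le [FiniteDimensional ℝ E] {n : ℕ} (hn : Module.finrank ℝ E = n)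
    {A W : E →ₗ[ℝ] E} (hA : A.IsSymmetric) {θ R : ℝ} (hθ : 0 < θ) {α : Fin k → ℝ}
    (hpos : ∀ j, 0 < α j) (hanti : StrictAnti α)
    (hAW : ∀ x, A x = W x + θ • ∑ l, (α l * ⟪e l, x⟫_ℝ) • e l)
    (hW : ∀ x, ‖W x‖ ≤ R * ‖x‖) (hg : 0 ≤ g) (hkg : k * g < 1)
    (hgram : ∀ j l, |⟪e j, e l⟫_ℝ - if j = l then 1 else 0| ≤ g) (i : Fin k) (hi : (i : ℕ) < n) :
    |hA.eigenvalues hn ⟨i, hi⟩ - θ * α i| ≤ R + θ * α i * (k * g) := by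
  set lam := hA.eigenvalues hn ⟨i, hi⟩ with hlam
  have hquad (x : E) : ⟪A x, x⟫_ℝ = ⟪W x, x⟫_ℝ + θ * ∑ l, α l * ⟪e l, x⟫_ℝ ^ 2 := by
    rw [hAW, inner_add_left, inner_smul_left, sum_inner]
    simp only [inner_smul_left, conj_trivial]
    congr 2
    exact Finset.sum_congr rfl fun l _ => by ring
  have hWq (x : E) : |⟪W x, x⟫_ℝ| ≤ R * ‖x‖ ^ 2 := by
    refine (abs_real_inner_le_norm _ _).trans ?_
    rw [sq, ← mul_assoc]
    exact mul_le_mul_of_nonneg_right (hW x) (norm_nonneg _)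
  have hθα : 0 < θ * α i := mul_pos hθ (hpos i)
  rw [abs_sub_le_iff]
  constructor
  -- Upper bound: a vector in the span of the top `i + 1` eigenvectors that is orthogonal to the
  -- signals stronger than `e i`.
  · obtain ⟨a, ha0, has, hax⟩ := exists_ne_zero_forall_inner_eq_zero
      (fun j => hA.eigenvectorBasis hn j) e (Finset.Iic ⟨i, hi⟩) (Finset.Iio i) (by simp)
    set x := ∑ l, a l • hA.eigenvectorBasis hn l with hx
    have hco (j : Fin n) : ⟪hA.eigenvectorBasis hn j, x⟫_ℝ = a j := by
      rw [hx]; exact (hA.eigenvectorBasis hn).orthonormal.inner_right_fintype a j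
    have hxpos : 0 < ‖x‖ ^ 2 := by
      have : x ≠ 0 := fun h => ha0 (funext fun j => by rw [← hco, h]; simp)
      positivity
    have h1 := eigenvalue_mul_le_inner_apply hA hn ⟨i, hi⟩ x (fun j hj => by
      rw [hco]; exact has j (by simpa using hj))
    rw [hquad] at h1
    have h2 := (abs_le.1 (hWq x)).2
    have h3 : ∑ l, α l * ⟪e l, x⟫_ℝ ^ 2 ≤ α i * ∑ l, ⟪e l, x⟫_ℝ ^ 2 := by
      rw [Finset.mul_sum]
      refine Finset.sum_le_sum fun l _ => ?_
      rcases lt_or_ge l i with h | h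
      · simp [hax l (Finset.mem_Iio.2 h)]
      · exact mul_le_mul_of_nonneg_right (hanti.antitone h) (sq_nonneg _)
    have h4 := sum_inner_sq_le hg hgram x
    have h5 : θ * ∑ l, α l * ⟪e l, x⟫_ℝ ^ 2 ≤ θ * α i * ((1 + k * g) * ‖x‖ ^ 2) := by
      rw [mul_assoc]
      exact mul_le_mul_of_nonneg_left (h3.trans (mul_le_mul_of_nonneg_left h4 (hpos i).le)) hθ.le
    refine le_of_mul_le_mul_right ?_ hxpos
    rw [← hlam] at h1
    linarith
  -- Lower bound: a combination of the `i + 1` strongest signals that is orthogonal to the top `i`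
  -- eigenvectors.
  · obtain ⟨a, ha0, has, hax⟩ := exists_ne_zero_forall_inner_eq_zero
      e (fun j => hA.eigenvectorBasis hn j) (Finset.Iic i) (Finset.Iio ⟨i, hi⟩) (by simp)
    set x := ∑ l, a l • e l with hx
    set s := ∑ l, a l ^ 2 with hs
    have hspos : 0 < s := by
      obtain ⟨j, hj⟩ := Function.ne_iff.1 ha0
      exact Finset.sum_pos' (fun _ _ => sq_nonneg _) ⟨j, Finset.mem_univ _, by
        have : a j ≠ 0 := hj
        positivity⟩
    have hxs := (abs_le.1 (abs_norm_sq_sum_sub_le hg hgram a)).1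
    rw [← hx, ← hs] at hxs
    have hxpos : 0 < ‖x‖ ^ 2 := by nlinarith
    have h1 := inner_apply_le_eigenvalue_mul hA hn ⟨i, hi⟩ x (fun j hj =>
      hax j (Finset.mem_Iio.2 hj))
    rw [hquad, ← hlam] at h1
    have h2 := (abs_le.1 (hWq x)).1
    set q := ∑ l ∈ Finset.Iic i, ⟪e l, x⟫_ℝ ^ 2 with hq
    have h3 : α i * q ≤ ∑ l, α l * ⟪e l, x⟫_ℝ ^ 2 := by
      rw [hq, Finset.mul_sum]
      calc _ ≤ ∑ l ∈ Finset.Iic i, α l * ⟪e l, x⟫_ℝ ^ 2 :=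
            Finset.sum_le_sum fun l hl =>
              mul_le_mul_of_nonneg_right (hanti.antitone (Finset.mem_Iic.1 hl)) (sq_nonneg _)
        _ ≤ _ := Finset.sum_le_sum_of_subset_of_nonneg (Finset.subset_univ _)
            fun l _ _ => mul_nonneg (hpos l).le (sq_nonneg _)
    have h4 : ‖x‖ ^ 2 = ∑ l ∈ Finset.Iic i, a l * ⟪e l, x⟫_ℝ := by
      rw [Finset.sum_subset (Finset.subset_univ _) (fun l _ hl => by rw [has l hl, zero_mul]),
        ← real_inner_self_eq_norm_sq]
      nth_rewrite 1 [hx]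
      rw [sum_inner]
      exact Finset.sum_congr rfl fun l _ => by rw [inner_smul_left]; simp
    -- Together with `(1 - k g) s ≤ ‖x‖²`, this gives a reverse Bessel inequality on the span of the
    -- signals.
    have h5 : (‖x‖ ^ 2) ^ 2 ≤ s * q := by
      rw [h4]
      refine (Finset.sum_mul_sq_le_sq_mul_sq _ _ _).trans ?_
      refine mul_le_mul_of_nonneg_right ?_ (Finset.sum_nonneg fun _ _ => sq_nonneg _)
      exact Finset.sum_le_sum_of_subset_of_nonneg (Finset.subset_univ _) fun _ _ _ => sq_nonneg _
    have hq0 : 0 ≤ q := Finset.sum_nonneg fun _ _ => sq_nonneg _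
    have h6 : (1 - k * g) * ‖x‖ ^ 2 ≤ q := by
      refine le_of_mul_le_mul_right ?_ hxpos
      nlinarith
    have h7 : θ * α i * ((1 - k * g) * ‖x‖ ^ 2) ≤ θ * ∑ l, α l * ⟪e l, x⟫_ℝ ^ 2 := by
      rw [mul_assoc]
      exact mul_le_mul_of_nonneg_left ((mul_le_mul_of_nonneg_left h6 (hpos i).le).trans h3) hθ.le
    refine le_of_mul_le_mul_right ?_ hxpos
    linarith

end Gram

end Spectral

/-! ### Deterministic comparison of eigenvector and signal. -/

section Eigenvector

open scoped InnerProductSpace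

variable {E : Type*} [NormedAddCommGroup E] [InnerProductSpace ℝ E] {k : ℕ} {e : Fin k → E}
  {g : ℝ}

theorem abs_norm_sub_one_le_of_gram
    (hgram : ∀ j l, |⟪e j, e l⟫_ℝ - if j = l then 1 else 0| ≤ g) (j : Fin k) :
    |‖e j‖ - 1| ≤ g := by
  have h := hgram j j
  rw [if_pos rfl, real_inner_self_eq_norm_sq] at h
  refine le_trans ?_ h
  rw [show ‖e j‖ ^ 2 - 1 = (‖e j‖ - 1) * (‖e j‖ + 1) by ring, abs_mul]
  have h1 : 1 ≤ |‖e j‖ + 1| := by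
    rw [abs_of_nonneg (by positivity)]; linarith [norm_nonneg (e j)]
  exact le_mul_of_one_le_right (abs_nonneg _) h1

/-- Pair the eigenvector equation with `e j`. Once `lam` is at distance of order `θ` from `θ * α j`,
the overlap with `e j` is small. -/
theorem abs_eigenvalue_sub_mul_abs_inner_le {W : E →ₗ[ℝ] E} {θ R lam : ℝ} {α : Fin k → ℝ} {v : E}
    (hθ : 0 ≤ θ) (hα : ∀ l, 0 ≤ α l) (hW : ∀ x, ‖W x‖ ≤ R * ‖x‖) (hg1 : g ≤ 1)
    (hgram : ∀ j l, |⟪e j, e l⟫_ℝ - if j = l then 1 else 0| ≤ g) (hv : ‖v‖ = 1)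
    (heig : lam • v = W v + θ • ∑ l, (α l * ⟪e l, v⟫_ℝ) • e l) (j : Fin k) :
    |lam - θ * α j| * |⟪e j, v⟫_ℝ| ≤ 2 * R + θ * ((∑ l, α l) * (2 * g)) := by
  have hnorm (l : Fin k) : ‖e l‖ ≤ 2 := by
    have := (abs_le.1 (abs_norm_sub_one_le_of_gram hgram l)).2
    linarith
  have hc (l : Fin k) : |⟪e l, v⟫_ℝ| ≤ 2 := by
    have := abs_real_inner_le_norm (e l) v
    rw [hv, mul_one] at this
    exact this.trans (hnorm l)
  have h1 : (lam - θ * α j) * ⟪e j, v⟫_ℝ = ⟪e j, W v⟫_ℝ +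
      θ * ∑ l, α l * ⟪e l, v⟫_ℝ * (⟪e j, e l⟫_ℝ - if j = l then 1 else 0) := by
    have := congrArg (fun z => ⟪e j, z⟫_ℝ) heig
    simp only [inner_add_right, inner_smul_right, inner_sum] at this
    simp only [mul_sub, Finset.sum_sub_distrib, mul_ite, mul_one, mul_zero, Finset.sum_ite_eq,
      Finset.mem_univ, if_true]
    linarith
  rw [← abs_mul, h1]
  refine (abs_add_le _ _).trans (add_le_add ?_ ?_)
  · refine (abs_real_inner_le_norm _ _).trans ?_
    have := hW v
    rw [hv, mul_one] at this
    exact mul_le_mul (hnorm j) this (norm_nonneg _) (by norm_num)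
  · rw [abs_mul, abs_of_nonneg hθ, Finset.sum_mul]
    refine mul_le_mul_of_nonneg_left ?_ hθ
    refine (Finset.abs_sum_le_sum_abs _ _).trans (Finset.sum_le_sum fun l _ => ?_)
    rw [abs_mul, abs_mul, abs_of_nonneg (hα l), mul_assoc]
    exact mul_le_mul_of_nonneg_left
      (mul_le_mul (hc l) (hgram j l) (abs_nonneg _) (by norm_num)) (hα l)

/-- A finite Neumann series with exact remainder, needing no convergence. -/
theorem eq_sum_pow_add_of_smul_eq {W : E →ₗ[ℝ] E} {lam : ℝ} (hlam : lam ≠ 0) {v y : E}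
    (h : lam • v = W v + y) (m : ℕ) :
    v = ∑ n ∈ Finset.range m, (lam⁻¹) ^ (n + 1) • (W ^ n) y + (lam⁻¹) ^ m • (W ^ m) v := by
  have hv : v = lam⁻¹ • (W v + y) := by rw [← h, smul_smul, inv_mul_cancel₀ hlam, one_smul]
  induction m with
  | zero => simp
  | succ m ih =>
    have hm : (W ^ m) v = lam⁻¹ • ((W ^ (m + 1)) v + (W ^ m) y) := by
      nth_rewrite 1 [hv]
      rw [map_smul, map_add, pow_succ W m, Module.End.mul_apply]
    nth_rewrite 1 [ih]
    rw [hm, Finset.sum_range_succ, smul_smul, ← pow_succ, smul_add]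
    abel

/-- Control of the coefficient of the `i`-th signal in the eigenvector equation. -/
theorem abs_coeff_sub_one_le {W : E →ₗ[ℝ] E} {θ R lam t κ : ℝ} {α : Fin k → ℝ} {v : E}
    {i : Fin k} (hθ : 0 ≤ θ) (hα : ∀ l, 0 ≤ α l) (hW : ∀ x, ‖W x‖ ≤ R * ‖x‖) (hg1 : g ≤ 1 / 2)
    (hgram : ∀ j l, |⟪e j, e l⟫_ℝ - if j = l then 1 else 0| ≤ g) (hv : ‖v‖ = 1)
    (hlam : 0 < lam) (ht : θ / lam ≤ t) (hsign : 0 ≤ ⟪e i, v⟫_ℝ)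
    (heig : lam • v = W v + θ • ∑ l, (α l * ⟪e l, v⟫_ℝ) • e l)
    (hκ : ∀ j, j ≠ i → |⟪e j, v⟫_ℝ| ≤ κ) (hκ0 : 0 ≤ κ) :
    |θ / lam * (α i * ⟪e i, v⟫_ℝ) - 1| ≤
      R / lam + t * ((∑ l, α l) * (2 * κ)) + 2 * (t * α i) * g := by
  have hnorm (l : Fin k) : ‖e l‖ ≤ 2 := by
    have := (abs_le.1 (abs_norm_sub_one_le_of_gram hgram l)).2
    linarith
  have ht0 : 0 ≤ θ / lam := by positivity
  set s := θ / lam * (α i * ⟪e i, v⟫_ℝ) with hs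
  have hs0 : 0 ≤ s := mul_nonneg ht0 (mul_nonneg (hα i) hsign)
  have hs2 : s ≤ 2 * (t * α i) := by
    have := abs_real_inner_le_norm (e i) v
    rw [hv, mul_one, abs_of_nonneg hsign] at this
    calc s ≤ t * (α i * 2) := mul_le_mul ht
          (mul_le_mul_of_nonneg_left (this.trans (hnorm i)) (hα i))
          (mul_nonneg (hα i) hsign) (ht0.trans ht)
      _ = _ := by ring
  have hv' : v - s • e i = lam⁻¹ • W v +
      (θ / lam) • ∑ l ∈ Finset.univ.erase i, (α l * ⟪e l, v⟫_ℝ) • e l := by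
    have h1 : v = lam⁻¹ • (lam • v) := by rw [smul_smul, inv_mul_cancel₀ hlam.ne', one_smul]
    rw [heig, ← Finset.add_sum_erase _ _ (Finset.mem_univ i)] at h1
    nth_rewrite 1 [h1]
    rw [hs, smul_add, smul_smul, smul_add, smul_smul, div_eq_inv_mul]
    abel_nf
  have hd : ‖v - s • e i‖ ≤ R / lam + t * ((∑ l, α l) * (2 * κ)) := by
    rw [hv']
    refine (norm_add_le _ _).trans (add_le_add ?_ ?_)
    · rw [norm_smul, Real.norm_eq_abs, abs_of_pos (inv_pos.2 hlam), div_eq_inv_mul]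
      have := hW v
      rw [hv, mul_one] at this
      exact mul_le_mul_of_nonneg_left this (inv_pos.2 hlam).le
    · rw [norm_smul, Real.norm_eq_abs, abs_of_nonneg ht0]
      refine mul_le_mul ht ?_ (norm_nonneg _) (ht0.trans ht)
      rw [Finset.sum_mul]
      refine (norm_sum_le _ _).trans ?_
      calc _ ≤ ∑ l ∈ Finset.univ.erase i, α l * (2 * κ) := by
            refine Finset.sum_le_sum fun l hl => ?_
            rw [norm_smul, Real.norm_eq_abs, abs_mul, abs_of_nonneg (hα l), mul_assoc, mul_comm 2]
            exact mul_le_mul_of_nonneg_left (mul_le_mul (hκ l (Finset.ne_of_mem_erase hl))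
              (hnorm l) (norm_nonneg _) hκ0) (hα l)
        _ ≤ _ := Finset.sum_le_sum_of_subset_of_nonneg (Finset.subset_univ _)
            fun l _ _ => mul_nonneg (hα l) (by positivity)
  -- Reverse triangle inequality. The sign convention gives `s ≥ 0`, which excludes `s` near `-1`.
  have h2 : |s * ‖e i‖ - 1| ≤ ‖v - s • e i‖ := by
    have := abs_norm_sub_norm_le v (s • e i)
    rw [hv, norm_smul, Real.norm_eq_abs, abs_of_nonneg hs0] at this
    rwa [abs_sub_comm]
  calc |s - 1| = |(s * ‖e i‖ - 1) - s * (‖e i‖ - 1)| := by ring_nf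
    _ ≤ |s * ‖e i‖ - 1| + |s * (‖e i‖ - 1)| := abs_sub _ _
    _ ≤ _ := by
      refine add_le_add (h2.trans hd) ?_
      rw [abs_mul, abs_of_nonneg hs0]
      exact mul_le_mul hs2 (abs_norm_sub_one_le_of_gram hgram i) (abs_nonneg _) (hs0.trans hs2)

theorem norm_pow_apply_le {W : E →ₗ[ℝ] E} {R : ℝ} (hR : 0 ≤ R) (hW : ∀ x, ‖W x‖ ≤ R * ‖x‖)
    (m : ℕ) (x : E) : ‖(W ^ m) x‖ ≤ R ^ m * ‖x‖ := by
  induction m with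
  | zero => simp
  | succ m ih =>
    rw [pow_succ', Module.End.mul_apply, pow_succ', mul_assoc]
    exact (hW _).trans (mul_le_mul_of_nonneg_left ih hR)

/-- Evaluation of an eigenvector against a functional, from the Neumann series. -/
theorem abs_functional_sub_le {W : E →ₗ[ℝ] E} {θ R lam t κ ε b : ℝ} {α : Fin k → ℝ} {v : E}
    {i : Fin k} (hθ : 0 < θ) (hα : ∀ l, 0 ≤ α l) (hR : 0 ≤ R) (hW : ∀ x, ‖W x‖ ≤ R * ‖x‖)
    (hv : ‖v‖ = 1) (hlam : 0 < lam) (ht : θ / lam ≤ t) (htR : t * (R / θ) ≤ 1 / 2)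
    (heig : lam • v = W v + θ • ∑ l, (α l * ⟪e l, v⟫_ℝ) • e l)
    (hc : ∀ j, |⟪e j, v⟫_ℝ| ≤ 2)
    (hκ : ∀ j, j ≠ i → |⟪e j, v⟫_ℝ| ≤ κ) (hκ0 : 0 ≤ κ)
    (hε : |θ / lam * (α i * ⟪e i, v⟫_ℝ) - 1| ≤ ε)
    (φ : E →ₗ[ℝ] ℝ) (hφ : ∀ x, |φ x| ≤ ‖x‖) (hb : 0 ≤ b) {m : ℕ}
    (hφb : ∀ n ≤ m, ∀ j, |φ ((W ^ n) (e j))| ≤ b * R ^ n) :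
    |φ (v - e i)| ≤ b * (ε + t * (∑ l, α l) * κ + 4 * t ^ 2 * (∑ l, α l) * (R / θ))
      + (t * (R / θ)) ^ (m + 1) := by
  set S := ∑ l, α l with hS
  have hS0 : 0 ≤ S := Finset.sum_nonneg fun l _ => hα l
  have ht0 : 0 ≤ θ / lam := by positivity
  have ht0' : 0 ≤ t := ht0.trans ht
  have hRl : R / lam ≤ t * (R / θ) := by
    calc R / lam = θ / lam * (R / θ) := by field_simp
      _ ≤ _ := mul_le_mul_of_nonneg_right ht (by positivity)
  set r := t * (R / θ) with hr
  have hr0 : 0 ≤ r := by positivity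
  set y := θ • ∑ l, (α l * ⟪e l, v⟫_ℝ) • e l with hy
  have hexp := eq_sum_pow_add_of_smul_eq hlam.ne' heig (m + 1)
  rw [Finset.sum_range_succ'] at hexp
  have hφy (n : ℕ) (hn : n ≤ m) : |φ ((W ^ n) y)| ≤ θ * (2 * S * (b * R ^ n)) := by
    rw [hy, map_smul, map_smul, smul_eq_mul, abs_mul, abs_of_pos hθ, map_sum, map_sum]
    refine mul_le_mul_of_nonneg_left ?_ hθ.le
    refine (Finset.abs_sum_le_sum_abs _ _).trans ?_
    rw [hS, Finset.mul_sum, Finset.sum_mul]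
    refine Finset.sum_le_sum fun l _ => ?_
    rw [map_smul, map_smul, smul_eq_mul, abs_mul, abs_mul, abs_of_nonneg (hα l), mul_comm 2]
    exact mul_le_mul (mul_le_mul_of_nonneg_left (hc l) (hα l)) (hφb n hn l) (abs_nonneg _)
      (mul_nonneg (hα l) (by norm_num))
  have hzero : |φ (lam⁻¹ ^ (0 + 1) • (W ^ 0) y) - φ (e i)| ≤ b * (ε + t * S * κ) := by
    have hb0 (j : Fin k) : |φ (e j)| ≤ b := by simpa using hφb 0 (Nat.zero_le _) j
    have h1 : φ (lam⁻¹ ^ (0 + 1) • (W ^ 0) y) - φ (e i) =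
        (θ / lam * (α i * ⟪e i, v⟫_ℝ) - 1) * φ (e i) +
        θ / lam * ∑ l ∈ Finset.univ.erase i, α l * ⟪e l, v⟫_ℝ * φ (e l) := by
      rw [zero_add, pow_one, pow_zero, Module.End.one_apply, hy, map_smul, map_smul, map_sum,
        ← Finset.add_sum_erase _ _ (Finset.mem_univ i)]
      simp only [map_smul, smul_eq_mul]
      ring
    rw [h1, mul_add]
    refine (abs_add_le _ _).trans (add_le_add ?_ ?_)
    · rw [abs_mul, mul_comm b]
      exact mul_le_mul hε (hb0 i) (abs_nonneg _) ((abs_nonneg _).trans hε)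
    · rw [abs_mul, abs_of_nonneg ht0, show b * (t * S * κ) = t * (S * (κ * b)) by ring]
      refine mul_le_mul ht ?_ (abs_nonneg _) ht0'
      refine (Finset.abs_sum_le_sum_abs _ _).trans ?_
      rw [hS, Finset.sum_mul]
      calc _ ≤ ∑ l ∈ Finset.univ.erase i, α l * (κ * b) := by
            refine Finset.sum_le_sum fun l hl => ?_
            rw [abs_mul, abs_mul, abs_of_nonneg (hα l), mul_assoc]
            exact mul_le_mul_of_nonneg_left (mul_le_mul (hκ l (Finset.ne_of_mem_erase hl))
              (hb0 l) (abs_nonneg _) hκ0) (hα l)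
        _ ≤ _ := Finset.sum_le_sum_of_subset_of_nonneg (Finset.subset_univ _)
            fun l _ _ => mul_nonneg (hα l) (by positivity)
  -- Geometric series of ratio at most `1 / 2`; the factor `b` is kept because `φ` is bounded on
  -- each `W ^ n (e j)` separately.
  have hmid : |φ (∑ n ∈ Finset.range m, lam⁻¹ ^ (n + 1 + 1) • (W ^ (n + 1)) y)| ≤
      b * (4 * t ^ 2 * S * (R / θ)) := by
    rw [map_sum]
    refine (Finset.abs_sum_le_sum_abs _ _).trans ?_
    calc _ ≤ ∑ n ∈ Finset.range m, 2 * S * t * b * r * (1 / 2) ^ n := by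
          refine Finset.sum_le_sum fun n hn => ?_
          have hn' := Finset.mem_range.1 hn
          rw [map_smul, smul_eq_mul, abs_mul, abs_of_nonneg (by positivity)]
          calc _ ≤ lam⁻¹ ^ (n + 1 + 1) * (θ * (2 * S * (b * R ^ (n + 1)))) :=
                mul_le_mul_of_nonneg_left (hφy _ (by omega)) (by positivity)
            _ = 2 * S * (θ / lam) * b * (R / lam) * (R / lam) ^ n := by
                simp only [div_eq_mul_inv]; ring
            _ ≤ _ := by
                have hpow := pow_le_pow_left₀ (by positivity) (hRl.trans htR) n
                gcongr
      _ = 2 * S * t * b * r * ∑ n ∈ Finset.range m, (1 / 2 : ℝ) ^ n := by rw [← Finset.mul_sum]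
      _ ≤ 2 * S * t * b * r * 2 := by
          gcongr
          exact sum_geometric_two_le m
      _ = _ := by rw [hr]; ring
  -- Only the norm of `W` controls this term, without the factor `b`; its smallness comes from the
  -- high power.
  have hlast : |φ (lam⁻¹ ^ (m + 1) • (W ^ (m + 1)) v)| ≤ r ^ (m + 1) := by
    rw [map_smul, smul_eq_mul, abs_mul, abs_of_nonneg (by positivity)]
    have h1 := (hφ _).trans (norm_pow_apply_le hR hW (m + 1) v)
    rw [hv, mul_one] at h1
    calc _ ≤ lam⁻¹ ^ (m + 1) * R ^ (m + 1) := mul_le_mul_of_nonneg_left h1 (by positivity)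
      _ = (R / lam) ^ (m + 1) := by rw [div_eq_inv_mul, mul_pow]
      _ ≤ _ := by gcongr
  have hfin : φ (v - e i) = φ (∑ n ∈ Finset.range m, lam⁻¹ ^ (n + 1 + 1) • (W ^ (n + 1)) y) +
      (φ (lam⁻¹ ^ (0 + 1) • (W ^ 0) y) - φ (e i)) + φ (lam⁻¹ ^ (m + 1) • (W ^ (m + 1)) v) := by
    rw [map_sub]
    nth_rewrite 1 [hexp]
    rw [map_add, map_add]
    ring
  rw [hfin]
  refine (abs_add_three _ _ _).trans ?_
  linarith

theorem eventually_nhdsGT_mul_le (c : ℝ) {d : ℝ} (hd : 0 < d) :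
    ∀ᶠ ρ in nhdsWithin (0 : ℝ) (Set.Ioi 0), c * ρ ≤ d := by
  have h : Tendsto (fun ρ : ℝ => c * ρ) (nhds 0) (nhds 0) := by
    have : Continuous fun ρ : ℝ => c * ρ := by fun_prop
    simpa using this.tendsto 0
  exact nhdsWithin_le_nhds ((h.eventually (gt_mem_nhds hd)).mono fun _ h => h.le)

/-- Uniform comparison of an eigenvector of a spiked operator with the corresponding signal. -/
theorem exists_abs_functional_sub_le {k : ℕ} {α : Fin k → ℝ} (hpos : ∀ j, 0 < α j)
    (hanti : StrictAnti α) {γ : ℝ} (hγ : 0 ≤ γ) (i : Fin k) :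
    ∃ C > 0, ∃ ρ₀ > 0, ∀ (N n : ℕ)
      (A W : EuclideanSpace ℝ (Fin N) →ₗ[ℝ] EuclideanSpace ℝ (Fin N))
      (hA : A.IsSymmetric) (hn : Module.finrank ℝ (EuclideanSpace ℝ (Fin N)) = n)
      (θ R g b : ℝ) (e : Fin k → EuclideanSpace ℝ (Fin N)) (v : EuclideanSpace ℝ (Fin N)) (m : ℕ)
      (hi : (i : ℕ) < n),
      0 < θ → 0 ≤ R → 0 ≤ g → 0 ≤ b → R / θ ≤ ρ₀ → g ≤ γ * (R / θ) →
      (∀ x, A x = W x + θ • ∑ l, (α l * ⟪e l, x⟫_ℝ) • e l) →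
      (∀ x, ‖W x‖ ≤ R * ‖x‖) →
      (∀ j l, |⟪e j, e l⟫_ℝ - if j = l then 1 else 0| ≤ g) →
      ‖v‖ = 1 → A v = hA.eigenvalues hn ⟨i, hi⟩ • v → 0 ≤ ⟪e i, v⟫_ℝ →
      ∀ φ : EuclideanSpace ℝ (Fin N) →ₗ[ℝ] ℝ, (∀ x, |φ x| ≤ ‖x‖) →
      (∀ n ≤ m, ∀ j, |φ ((W ^ n) (e j))| ≤ b * R ^ n) →
      |φ (v - e i)| ≤ C * (b * (R / θ)) + (C * (R / θ)) ^ (m + 1) := by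
  have hδ : ∃ δ > 0, ∀ j, j ≠ i → δ ≤ |α i - α j| := by
    have h1 : ∀ᶠ δ in nhdsWithin (0 : ℝ) (Set.Ioi 0), ∀ j, j ≠ i → δ ≤ |α i - α j| := by
      refine eventually_all.2 fun j => ?_
      by_cases hj : j = i
      · exact Eventually.of_forall fun _ h => absurd hj h
      · have := eventually_nhdsGT_mul_le 1
          (abs_pos.2 (sub_ne_zero.2 (hanti.injective.ne (Ne.symm hj))))
        exact this.mono fun δ h _ => by simpa using h
    obtain ⟨δ, h, hpos⟩ := (h1.and self_mem_nhdsWithin).exists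
    exact ⟨δ, hpos, h⟩
  obtain ⟨δ, hδ, hgap⟩ := hδ
  set σ := ∑ l, α l with hσ
  have hσ0 : 0 ≤ σ := Finset.sum_nonneg fun l _ => (hpos l).le
  have hαi := hpos i
  set t := 2 / α i with ht
  have ht0 : 0 < t := by positivity
  -- The overlap error `θ ρ (2 + 2 σ γ)` divided by the eigenvalue gap `θ δ / 2`, where `ρ = R / θ`.
  set K := (4 + 4 * σ * γ) / δ with hK
  have hK0 : 0 ≤ K := by positivity
  -- In order: `k g < 1`; `g ≤ 1/2`; eigenvalue error at most half the gap; `lam ≥ θ α i / 2`;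
  -- Neumann ratio at most `1/2`.
  obtain ⟨ρ₀, ⟨⟨⟨⟨h1, h2⟩, h3⟩, h4⟩, h5⟩, hρ₀⟩ :=
    (((((eventually_nhdsGT_mul_le (k * γ) (d := 1 / 2) (by norm_num)).and
      (eventually_nhdsGT_mul_le γ (d := 1 / 2) (by norm_num))).and
      (eventually_nhdsGT_mul_le (1 + α i * (k * γ)) (d := δ / 2) (by positivity))).and
      (eventually_nhdsGT_mul_le (1 + α i * (k * γ)) (d := α i / 2) (by positivity))).and
      (eventually_nhdsGT_mul_le t (d := 1 / 2) (by norm_num))).and self_mem_nhdsWithin |>.exists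
  -- The three contributions to the factor of `b` in `abs_functional_sub_le`. The leading `t` also
  -- makes this constant dominate the base of the remainder.
  refine ⟨(t + t * (σ * (2 * K)) + 2 * (t * α i) * γ) + t * σ * K + 4 * t ^ 2 * σ, by positivity,
    ρ₀, hρ₀, ?_⟩
  intro N n A W hA hn θ R g b e v m hi hθ hR hg hb hρ hgγ hAW hW hgram hv heig hsign φ hφ hφb
  set ρ := R / θ with hρdef
  have hρ0 : 0 ≤ ρ := by positivity
  have hRρ : R = ρ * θ := by rw [hρdef]; field_simp
  have mono {c d : ℝ} (hc : 0 ≤ c) (h : c * ρ₀ ≤ d) : c * ρ ≤ d :=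
    (mul_le_mul_of_nonneg_left hρ hc).trans h
  replace h1 := mono (by positivity) h1
  replace h2 := mono (by positivity) h2
  replace h3 := mono (by positivity) h3
  replace h4 := mono (by positivity) h4
  replace h5 := mono (by positivity) h5
  have hk0 : (0 : ℝ) ≤ k := by positivity
  have hkg : k * g ≤ k * γ * ρ := by rw [mul_assoc]; exact mul_le_mul_of_nonneg_left hgγ hk0
  set lam := hA.eigenvalues hn ⟨i, hi⟩ with hlam
  have hloc : |lam - θ * α i| ≤ θ * ((1 + α i * (k * γ)) * ρ) := by
    refine (abs_eigenvalue_sub_le hn hA hθ hpos hanti hAW hW hg (by linarith) hgram i hi).trans ?_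
    rw [hRρ]
    have : θ * α i * (k * g) ≤ θ * α i * (k * γ * ρ) :=
      mul_le_mul_of_nonneg_left hkg (by positivity)
    linarith
  have hlam1 : θ * α i / 2 ≤ lam := by
    have := (abs_le.1 hloc).1
    have := mul_le_mul_of_nonneg_left h4 hθ.le
    linarith
  have hlam0 : 0 < lam := lt_of_lt_of_le (by positivity) hlam1
  have htl : θ / lam ≤ t := by
    rw [ht, div_le_div_iff₀ hlam0 hαi]
    linarith
  have heig' : lam • v = W v + θ • ∑ l, (α l * ⟪e l, v⟫_ℝ) • e l := by rw [← hAW, heig]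
  have hκ (j : Fin k) (hj : j ≠ i) : |⟪e j, v⟫_ℝ| ≤ K * ρ := by
    have h6 := abs_eigenvalue_sub_mul_abs_inner_le hθ.le (fun l => (hpos l).le) hW
      (by linarith) hgram hv heig' j
    have h7 : θ * (δ / 2) ≤ |lam - θ * α j| := by
      have h8 : θ * δ ≤ |θ * α i - θ * α j| := by
        rw [← mul_sub, abs_mul, abs_of_pos hθ]
        exact mul_le_mul_of_nonneg_left (hgap j hj) hθ.le
      have h9 := abs_sub_le (θ * α i) lam (θ * α j)
      rw [abs_sub_comm (θ * α i) lam] at h9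
      have := mul_le_mul_of_nonneg_left h3 hθ.le
      linarith
    have h8 : θ * (δ / 2) * |⟪e j, v⟫_ℝ| ≤ θ * (δ / 2) * (K * ρ) := by
      refine (mul_le_mul_of_nonneg_right h7 (abs_nonneg _)).trans (h6.trans ?_)
      have h9 : θ * (σ * (2 * g)) ≤ θ * (σ * (2 * (γ * ρ))) := by gcongr
      have h10 : θ * (δ / 2) * (K * ρ) = 2 * (ρ * θ) + θ * (σ * (2 * (γ * ρ))) := by
        rw [hK]; field_simp; ring
      rw [h10, hRρ]
      linarith
    exact le_of_mul_le_mul_left h8 (by positivity)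
  have hc (j : Fin k) : |⟪e j, v⟫_ℝ| ≤ 2 := by
    have h6 := abs_real_inner_le_norm (e j) v
    have h7 := (abs_le.1 (abs_norm_sub_one_le_of_gram hgram j)).2
    rw [hv, mul_one] at h6
    linarith
  have hε : |θ / lam * (α i * ⟪e i, v⟫_ℝ) - 1| ≤
      (t + t * (σ * (2 * K)) + 2 * (t * α i) * γ) * ρ := by
    refine (abs_coeff_sub_one_le hθ.le (fun l => (hpos l).le) hW (by linarith) hgram hv hlam0 htl
      hsign heig' hκ (by positivity)).trans ?_
    have h6 : R / lam ≤ t * ρ := by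
      calc R / lam = θ / lam * ρ := by rw [hRρ]; ring
        _ ≤ _ := mul_le_mul_of_nonneg_right htl hρ0
    have h7 : 2 * (t * α i) * g ≤ 2 * (t * α i) * (γ * ρ) := by gcongr
    rw [← hσ]
    linarith
  refine (abs_functional_sub_le hθ (fun l => (hpos l).le) hR hW hv hlam0 htl h5 heig' hc hκ
    (by positivity) hε φ hφ hb hφb).trans ?_
  refine add_le_add (le_of_eq (by rw [← hσ, ← hρdef]; ring)) ?_
  refine pow_le_pow_left₀ (by positivity) (mul_le_mul_of_nonneg_right ?_ hρ0) _
  have : 0 ≤ t * (σ * (2 * K)) + 2 * (t * α i) * γ + t * σ * K + 4 * t ^ 2 * σ := by positivity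
  linarith

end Eigenvector

/-! ### Almost orthonormality of the sampled signals. -/

section RiemannSums

theorem gridPoint_mem_Icc {N : ℕ} (j : Fin N) : gridPoint j ∈ Set.Icc (0 : ℝ) 1 := by
  have hN : (0 : ℝ) < N := by exact_mod_cast j.pos
  refine ⟨by unfold gridPoint; positivity, ?_⟩
  rw [gridPoint, div_le_one hN]
  exact_mod_cast j.2

/-- Each of the `N` cells contributes at most `(L / N) (1 / N)`. The rate `1 / N` matters: it
becomes `O(1 / θ)` under `θ = O(N)`. -/
theorem abs_riemannSum_sub_integral_le {F : ℝ → ℝ} {L : ℝ} (hL : 0 ≤ L)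
    (hF : ∀ x ∈ Set.Icc (0 : ℝ) 1, ∀ y ∈ Set.Icc (0 : ℝ) 1, |F x - F y| ≤ L * |x - y|)
    {N : ℕ} (hN : N ≠ 0) :
    |(∑ j : Fin N, F (gridPoint j)) / N - ∫ x in Set.Icc (0 : ℝ) 1, F x| ≤ L / N := by
  have hN' : (0 : ℝ) < N := by exact_mod_cast Nat.pos_of_ne_zero hN
  have hcont : ContinuousOn F (Set.Icc 0 1) :=
    (LipschitzOnWith.of_dist_le_mul (K := L.toNNReal) fun x hx y hy => by
      rw [Real.dist_eq, Real.dist_eq, Real.coe_toNNReal L hL]; exact hF x hx y hy).continuousOn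
  have hpt (j : ℕ) (hj : j ≤ N) : (j : ℝ) / N ∈ Set.Icc (0 : ℝ) 1 :=
    ⟨by positivity, by rw [div_le_one hN']; exact_mod_cast hj⟩
  have hint (j : ℕ) (hj : j < N) :
      IntervalIntegrable F volume ((j : ℝ) / N) (((j + 1 : ℕ) : ℝ) / N) :=
    (hcont.mono (Set.ordConnected_Icc.uIcc_subset (hpt j hj.le) (hpt (j + 1) hj))).intervalIntegrable
  have hsum := intervalIntegral.sum_integral_adjacent_intervals (f := F) (μ := volume)
    (a := fun j : ℕ => (j : ℝ) / N) (n := N) hint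
  simp only [Nat.cast_zero, zero_div, div_self hN'.ne'] at hsum
  rw [integral_Icc_eq_integral_Ioc, ← intervalIntegral.integral_of_le zero_le_one, ← hsum,
    Finset.sum_div, ← Fin.sum_univ_eq_sum_range
      (fun j => ∫ x in ((j : ℝ) / N)..(((j + 1 : ℕ) : ℝ) / N), F x), ← Finset.sum_sub_distrib]
  calc _ ≤ ∑ j : Fin N, L / N * (1 / N) := by
        refine (Finset.abs_sum_le_sum_abs _ _).trans (Finset.sum_le_sum fun j _ => ?_)
        have hlen : ((j + 1 : ℕ) : ℝ) / N - (j : ℝ) / N = 1 / N := by push_cast; ring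
        have h1 : F (gridPoint j) / N =
            ∫ _ in ((j : ℝ) / N)..(((j + 1 : ℕ) : ℝ) / N), F (gridPoint j) := by
          rw [intervalIntegral.integral_const, hlen, smul_eq_mul]; ring
        rw [h1, ← intervalIntegral.integral_sub intervalIntegrable_const (hint j j.2)]
        have hle : (j : ℝ) / N ≤ ((j + 1 : ℕ) : ℝ) / N := by
          gcongr; simp
        have h2 := intervalIntegral.norm_integral_le_of_norm_le_const (C := L / N)
          (f := fun x => F (gridPoint j) - F x) (a := (j : ℝ) / N) (b := ((j + 1 : ℕ) : ℝ) / N)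
          (fun x hx => by
            rw [Set.uIoc_of_le hle] at hx
            have hx01 : x ∈ Set.Icc (0 : ℝ) 1 :=
              ⟨(hpt j j.2.le).1.trans hx.1.le, hx.2.trans (hpt (j + 1) j.2).2⟩
            refine (hF _ (gridPoint_mem_Icc j) x hx01).trans ?_
            rw [div_eq_mul_one_div, ← hlen]
            refine mul_le_mul_of_nonneg_left ?_ hL
            have hg : gridPoint j = ((j + 1 : ℕ) : ℝ) / N := by simp [gridPoint]
            rw [hg, abs_of_nonneg (by linarith [hx.2])]
            linarith [hx.1])
        rwa [hlen, abs_of_nonneg (by positivity)] at h2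
    _ = L / N := by
        rw [Finset.sum_const, Finset.card_univ, Fintype.card_fin, nsmul_eq_mul]
        field_simp

theorem exists_forall_abs_signal_le {k : ℕ} {h : Fin k → ℝ → ℝ} (h_orth : OrthonormalSignals h) :
    ∃ M : ℝ, 1 ≤ M ∧ ∀ i, ∀ x ∈ Set.Icc (0 : ℝ) 1, |h i x| ≤ M := by
  choose M hM using h_orth.bounded
  refine ⟨1 + ∑ i, |M i|, le_add_of_nonneg_right (Finset.sum_nonneg fun _ _ => abs_nonneg _),
    fun i x hx => ?_⟩
  have := Finset.single_le_sum (f := fun i => |M i|) (fun _ _ => abs_nonneg _) (Finset.mem_univ i)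
  linarith [hM i x hx, le_abs_self (M i)]

/-- The discretized signals are orthonormal up to an error of order `1 / N`. -/
theorem exists_abs_signalVector_dotProduct_sub_le {k : ℕ} {h : Fin k → ℝ → ℝ}
    (h_orth : OrthonormalSignals h) (h_lip : LipschitzSignals h) :
    ∃ C : ℝ, 0 ≤ C ∧ ∀ N : ℕ, N ≠ 0 → ∀ i j : Fin k,
      |signalVector N (h i) ⬝ᵥ signalVector N (h j) - if i = j then 1 else 0| ≤ C / N := by
  obtain ⟨M, hM1, hM⟩ := exists_forall_abs_signal_le h_orth
  choose L hL using h_lip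
  set S := ∑ i, |L i| with hS
  have hS0 : 0 ≤ S := Finset.sum_nonneg fun _ _ => abs_nonneg _
  have hLS (i : Fin k) (x y : ℝ) (hx : x ∈ Set.Icc (0 : ℝ) 1) (hy : y ∈ Set.Icc (0 : ℝ) 1) :
      |h i x - h i y| ≤ S * |x - y| := by
    refine (hL i x hx y hy).trans (mul_le_mul_of_nonneg_right ?_ (abs_nonneg _))
    exact (le_abs_self _).trans (Finset.single_le_sum (f := fun i => |L i|)
      (fun _ _ => abs_nonneg _) (Finset.mem_univ i))
  refine ⟨2 * M * S, by positivity, fun N hN i j => ?_⟩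
  have hN' : (0 : ℝ) < N := by exact_mod_cast Nat.pos_of_ne_zero hN
  have h1 : signalVector N (h i) ⬝ᵥ signalVector N (h j) =
      (∑ l : Fin N, h i (gridPoint l) * h j (gridPoint l)) / N := by
    rw [dotProduct, Finset.sum_div]
    refine Finset.sum_congr rfl fun l _ => ?_
    rw [signalVector, signalVector, div_mul_div_comm, Real.mul_self_sqrt hN'.le]
  rw [h1, ← h_orth.orthonormal i j]
  refine abs_riemannSum_sub_integral_le (F := fun x => h i x * h j x) (by positivity) ?_ hN
  intro x hx y hy
  calc |h i x * h j x - h i y * h j y| = |h i x * (h j x - h j y) + (h i x - h i y) * h j y| := by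
        ring_nf
    _ ≤ M * (S * |x - y|) + S * |x - y| * M := by
        refine (abs_add_le _ _).trans (add_le_add ?_ ?_)
        · rw [abs_mul]
          exact mul_le_mul (hM i x hx) (hLS j x y hx hy) (abs_nonneg _) (by linarith)
        · rw [abs_mul]
          exact mul_le_mul (hLS i x y hx hy) (hM j y hy) (abs_nonneg _) (by positivity)
    _ = _ := by ring

end RiemannSums

/-! ### The high-probability event for `W`. -/

section HighProbability

theorem SpikedWigner.WithHighProb.mono {Ω : ℕ → Type*} [∀ N, MeasurableSpace (Ω N)] {P : ∀ N, Measure (Ω N)}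
    [∀ N, IsProbabilityMeasure (P N)] {E F : ∀ N, Set (Ω N)} (hE : WithHighProb P E)
    (h : ∀ᶠ N in atTop, E N ⊆ F N) : WithHighProb P F := by
  obtain ⟨η, hη, hO⟩ := hE
  refine ⟨η, hη, IsBigO.trans (IsBigO.of_bound 1 ?_) hO⟩
  filter_upwards [h] with N hN
  rw [one_mul, Real.norm_of_nonneg measureReal_nonneg, Real.norm_of_nonneg measureReal_nonneg]
  exact measureReal_mono (Set.compl_subset_compl.2 hN)

theorem tendsto_log_natCast_atTop : Tendsto (fun N : ℕ => Real.log N) atTop atTop :=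
  Real.tendsto_log_atTop.comp tendsto_natCast_atTop_atTop

theorem eventually_mul_rpow_log_le {a b : ℝ} (hab : a < b) (c : ℝ) :
    ∀ᶠ N : ℕ in atTop, c * Real.log N ^ a ≤ Real.log N ^ b := by
  have h : Tendsto (fun N : ℕ => Real.log N ^ (b - a)) atTop atTop :=
    (tendsto_rpow_atTop (sub_pos.2 hab)).comp tendsto_log_natCast_atTop
  filter_upwards [h.eventually_ge_atTop c, tendsto_log_natCast_atTop.eventually_gt_atTop 0]
    with N h1 h2
  calc c * Real.log N ^ a ≤ Real.log N ^ (b - a) * Real.log N ^ a :=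
        mul_le_mul_of_nonneg_right h1 (by positivity)
    _ = _ := by rw [← Real.rpow_add h2]; ring_nf

theorem rpow_div_pow_le_exp_neg {B T L₀ : ℝ} {L : ℕ} (hB : 0 < B + 1) (hT : 0 < T)
    (hL : (L : ℝ) ≤ 12 * L₀) (h : Real.exp 1 * (12 * L₀) ^ (B + 1) ≤ T) :
    ((L : ℝ) ^ (B + 1) / T) ^ L ≤ Real.exp (-L) := by
  have h1 : (L : ℝ) ^ (B + 1) / T ≤ Real.exp (-1) := by
    rw [div_le_iff₀ hT, Real.exp_neg, ← div_eq_inv_mul, le_div_iff₀ (Real.exp_pos 1), mul_comm]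
    refine le_trans ?_ h
    gcongr
  calc _ ≤ Real.exp (-1) ^ L := pow_le_pow_left₀ (by positivity) h1 L
    _ = _ := by rw [← Real.exp_nat_mul]; ring_nf

/-- With high probability, `W` has norm at most `√N (log N)^τ`, and the entries of `Wⁿ u` are at
most `(√N (log N)^τ)ⁿ` for all `n ≤ ⌈log N⌉` and all `u` in a finite family of vectors with
entries in `[-1, 1]`. -/
theorem withHighProb_norm_le_and_pow_mulVec_le {Ω : ℕ → Type*} [∀ N, MeasurableSpace (Ω N)]
    {P : ∀ N, Measure (Ω N)} [∀ N, IsProbabilityMeasure (P N)] {f : ℝ → ℝ → ℝ} {B : ℝ} (hB : 0 < B)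
    {X : ∀ N, Fin N → Fin N → Ω N → ℝ} (hX : ∀ N, IsWignerArray (P N) f B (X N)) {k : ℕ}
    (u : ∀ N, Fin k → Fin N → ℝ) (hu : ∀ N j a, |u N j a| ≤ 1) {τ : ℝ} (hτ : B + 1 < τ) :
    WithHighProb P (fun N => {ω |
      (∀ x, ‖Matrix.toEuclideanLin (wignerMatrix (X N) ω) x‖ ≤
        Real.sqrt N * Real.log N ^ τ * ‖x‖) ∧
      ∀ n ≤ ⌈Real.log N⌉₊, ∀ j a, |(wignerMatrix (X N) ω ^ n *ᵥ u N j) a| ≤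
        (Real.sqrt N * Real.log N ^ τ) ^ n}) := by
  have hB1 : 0 < B + 1 := by linarith
  -- `η > 1` lets `exp (-(log N)^η)` absorb powers of `N`, while `η (B + 1) < τ` keeps `L ^ (B + 1)`
  -- well below `(log N)^τ`.
  obtain ⟨η, hη1, hητ⟩ : ∃ η : ℝ, 1 < η ∧ η * (B + 1) < τ := by
    obtain ⟨η, h1, h2⟩ := exists_between ((one_lt_div hB1).2 hτ)
    exact ⟨η, h1, (lt_div_iff₀ hB1).1 h2⟩
  refine ⟨η, hη1, IsBigO.of_bound (1 + k) ?_⟩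
  filter_upwards [eventually_mul_rpow_log_le hητ (Real.exp 1 * 12 ^ (B + 1)),
    tendsto_log_natCast_atTop.eventually_ge_atTop 1, eventually_ge_atTop 1] with N hT hlog hN1
  have hN : (0 : ℝ) < N := by exact_mod_cast hN1
  set l := Real.log N with hl
  have hl0 : 0 < l := by linarith
  set L₀ := l ^ η with hL₀
  set T := l ^ τ with hTdef
  have hTpos : 0 < T := by positivity
  have hlL : l ≤ L₀ := by
    calc l = l ^ (1 : ℝ) := (Real.rpow_one l).symm
      _ ≤ _ := Real.rpow_le_rpow_of_exponent_le hlog hη1.le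
  have hkey : Real.exp 1 * (12 * L₀) ^ (B + 1) ≤ T := by
    rw [Real.mul_rpow (by norm_num) (by positivity), hL₀, ← Real.rpow_mul hl0.le, ← mul_assoc]
    exact hT
  -- The factor `N ^ 3` pays for the union bound over `n`, `j` and `a`.
  set δ := Real.exp (-L₀) / N ^ 3 with hδ
  have hδ0 : 0 < δ := by positivity
  have hsmall (L : ℕ) (h1 : L₀ + 3 * l ≤ L) (h2 : (L : ℝ) ≤ 12 * L₀) :
      ((L : ℝ) ^ (B + 1) / T) ^ L ≤ δ := by
    refine (rpow_div_pow_le_exp_neg hB1 hTpos h2 hkey).trans ?_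
    calc Real.exp (-L) ≤ Real.exp (-L₀ - 3 * l) := Real.exp_le_exp.2 (by linarith)
      _ = δ := by
        rw [Real.exp_sub, hδ, show (3 : ℝ) * l = (3 : ℕ) * l by norm_num, Real.exp_nat_mul,
          hl, Real.exp_log hN]
  set m := ⌈l⌉₊ with hm
  have hml : (m : ℝ) < l + 1 := Nat.ceil_lt_add_one hl0.le
  have hmN : (m : ℝ) ≤ N := by
    have : m ≤ N := Nat.ceil_le.2 (Real.log_le_self hN.le)
    exact_mod_cast this
  let bad₁ : Set (Ω N) := {ω | ¬ ∀ x, ‖Matrix.toEuclideanLin (wignerMatrix (X N) ω) x‖ ≤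
    Real.sqrt N * T * ‖x‖}
  let bad₂ (n : ℕ) (j : Fin k) (a : Fin N) : Set (Ω N) :=
    {ω | (Real.sqrt N * T) ^ n < |(wignerMatrix (X N) ω ^ n *ᵥ u N j) a|}
  have hbad₁ : (P N).real bad₁ ≤ N * δ := by
    set q := ⌈L₀ + 3 * l⌉₊ with hq
    have hq1 : L₀ + 3 * l ≤ q := Nat.le_ceil _
    have hq2 : (q : ℝ) < L₀ + 3 * l + 1 := Nat.ceil_lt_add_one (by positivity)
    have hq0 : q ≠ 0 := by
      intro h0
      rw [h0] at hq1
      push_cast at hq1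
      linarith
    refine (measure_not_norm_le_le hB.le (hX N) hq0 hTpos).trans ?_
    gcongr
    refine hsmall _ ?_ ?_ <;> push_cast <;> linarith
  have hbad₂ (n : ℕ) (hn : n ∈ Finset.Icc 1 m) (j : Fin k) (a : Fin N) :
      (P N).real (bad₂ n j a) ≤ δ := by
    obtain ⟨hn1, hnm⟩ := Finset.mem_Icc.1 hn
    have hn0 : (1 : ℝ) ≤ n := by exact_mod_cast hn1
    have hnm' : (n : ℝ) ≤ m := by exact_mod_cast hnm
    -- The moment exponent is the even number `2 q`, so the walk length `2 q n` lies between `L₀ + 3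
    -- l` and `12 L₀`.
    set q := ⌈(L₀ + 3 * l) / n⌉₊ with hq
    have hq1 : (L₀ + 3 * l) / n ≤ q := Nat.le_ceil _
    have hq2 : (q : ℝ) < (L₀ + 3 * l) / n + 1 := Nat.ceil_lt_add_one (by positivity)
    rw [div_le_iff₀ (by linarith)] at hq1
    have hq3 : (q : ℝ) * n ≤ L₀ + 3 * l + n := by
      have := mul_le_mul_of_nonneg_right hq2.le (by linarith : (0 : ℝ) ≤ n)
      rwa [add_mul, div_mul_cancel₀ _ (by linarith), one_mul] at this
    have hqn : 2 ≤ 2 * q * n := by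
      have : (0 : ℝ) < ((q * n : ℕ) : ℝ) := by push_cast; linarith
      have : 0 < q * n := by exact_mod_cast this
      rw [mul_assoc]; omega
    refine (measure_pow_mulVec_apply_gt_le hB.le (hX N) (u N j) (hu N j) (even_two_mul q) hqn a
      hTpos).trans ?_
    refine hsmall _ ?_ ?_ <;> push_cast <;> nlinarith
  rw [Real.norm_of_nonneg measureReal_nonneg, Real.norm_of_nonneg (Real.exp_pos _).le]
  calc _ ≤ (P N).real (bad₁ ∪ ⋃ n ∈ Finset.Icc 1 m, ⋃ j ∈ (Finset.univ : Finset (Fin k)),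
          ⋃ a ∈ (Finset.univ : Finset (Fin N)), bad₂ n j a) := by
        refine measureReal_mono fun ω hω => ?_
        by_contra hcon
        simp only [Set.mem_union, Set.mem_iUnion, not_or, not_exists] at hcon
        refine hω ⟨not_not.1 hcon.1, fun n hn j a => ?_⟩
        rcases Nat.eq_zero_or_pos n with rfl | hn0
        · simpa using hu N j a
        · exact not_lt.1 (hcon.2 n (Finset.mem_Icc.2 ⟨hn0, hn⟩) j (Finset.mem_univ _) a
            (Finset.mem_univ _))
    _ ≤ N * δ + ∑ n ∈ Finset.Icc 1 m, ∑ j : Fin k, ∑ a : Fin N, δ := by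
        refine (measureReal_union_le _ _).trans (add_le_add hbad₁ ?_)
        refine (measureReal_biUnion_finset_le _ _).trans (Finset.sum_le_sum fun n hn => ?_)
        refine (measureReal_biUnion_finset_le _ _).trans (Finset.sum_le_sum fun j _ => ?_)
        refine (measureReal_biUnion_finset_le _ _).trans (Finset.sum_le_sum fun a _ => ?_)
        exact hbad₂ n hn j a
    _ = (N + m * k * N) * δ := by simp; ring
    _ ≤ ((1 + k) * N ^ 3) * δ := by
        refine mul_le_mul_of_nonneg_right ?_ hδ0.le
        have hN1' : (1 : ℝ) ≤ N := by exact_mod_cast hN1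
        have h1 : (N : ℝ) ≤ N ^ 3 := le_self_pow₀ hN1' (by norm_num)
        have h2 : (m : ℝ) * k * N ≤ k * N ^ 3 := by
          calc (m : ℝ) * k * N ≤ N * k * N := by gcongr
            _ = k * N ^ 2 := by ring
            _ ≤ k * N ^ 3 := by gcongr; norm_num
        linarith
    _ = _ := by rw [hδ]; field_simp

end HighProbability

/-! ### From the deterministic comparison to the sup norm. -/

section Delocalization

open scoped InnerProductSpace

theorem toEuclideanLin_pow_apply {N : ℕ} (W : Matrix (Fin N) (Fin N) ℝ) (n : ℕ)
    (u : Fin N → ℝ) :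
    (Matrix.toEuclideanLin W ^ n) (WithLp.toLp 2 u) = WithLp.toLp 2 (W ^ n *ᵥ u) := by
  induction n with
  | zero => simp
  | succ n ih =>
    rw [pow_succ', Module.End.mul_apply, ih, pow_succ', ← Matrix.mulVec_mulVec,
      Matrix.toLpLin_toLp, Matrix.toLin'_apply]

theorem inner_toLp_eq_dotProduct {N : ℕ} (u w : Fin N → ℝ) :
    ⟪(WithLp.toLp 2 u : EuclideanSpace ℝ (Fin N)), WithLp.toLp 2 w⟫_ℝ = u ⬝ᵥ w := by
  rw [EuclideanSpace.inner_toLp_toLp, star_trivial, dotProduct_comm]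

theorem toEuclideanLin_perturbedMatrix_apply {Ω : Type*} {N k : ℕ} (X : Fin N → Fin N → Ω → ℝ)
    (θ : ℝ) (α : Fin k → ℝ) (h : Fin k → ℝ → ℝ) (ω : Ω) (x : EuclideanSpace ℝ (Fin N)) :
    Matrix.toEuclideanLin (perturbedMatrix X θ α h ω) x =
      Matrix.toEuclideanLin (wignerMatrix X ω) x + θ • ∑ l,
        (α l * ⟪(WithLp.toLp 2 (signalVector N (h l)) : EuclideanSpace ℝ (Fin N)), x⟫_ℝ) •
          (WithLp.toLp 2 (signalVector N (h l)) : EuclideanSpace ℝ (Fin N)) := by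
  obtain ⟨w, rfl⟩ := (WithLp.toLp_surjective 2) x
  simp only [inner_toLp_eq_dotProduct]
  rw [perturbedMatrix, map_add, LinearMap.add_apply, map_smul, map_sum, LinearMap.smul_apply,
    LinearMap.sum_apply]
  congr 2
  refine Finset.sum_congr rfl fun l _ => ?_
  rw [map_smul, LinearMap.smul_apply, mul_smul, Matrix.toLpLin_toLp, Matrix.toLin'_apply,
    Matrix.vecMulVec_mulVec]
  congr 1
  ext a
  simp [mul_comm]

/-- With high probability, the eigenvector is uniformly close to the signal. -/
theorem withHighProb_norm_sub_signalVector_le {Ω : ℕ → Type*} [∀ N, MeasurableSpace (Ω N)]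
    (P : ∀ N, Measure (Ω N)) [∀ N, IsProbabilityMeasure (P N)] {f : ℝ → ℝ → ℝ}
    {B : ℝ} (hB : 0 < B)
    {X : ∀ N, Fin N → Fin N → Ω N → ℝ} (hX : ∀ N, IsWignerArray (P N) f B (X N))
    {k : ℕ} {α : Fin k → ℝ} (hα_pos : ∀ i, 0 < α i) (hα_anti : StrictAnti α)
    {h : Fin k → ℝ → ℝ} (h_orth : OrthonormalSignals h) (h_lip : LipschitzSignals h)
    {θ : ℕ → ℝ} (hθ_pos : ∀ N, 1 ≤ N → 0 < θ N) {ξ : ℝ} (hθ : GrowthCondition B ξ θ)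
    (i : Fin k) {v : ∀ N, Ω N → Fin N → ℝ}
    (hv : ∀ (N : ℕ) (hN : (i : ℕ) < N) (ω : Ω N),
      IsUnitEigenvector (perturbedMatrix_isHermitian (X N) (θ N) α h ω) i hN (v N ω))
    (hv_sign : ∀ (N : ℕ) (ω : Ω N), (i : ℕ) < N → 0 ≤ signalVector N (h i) ⬝ᵥ v N ω) :
    ∃ C : ℝ, 0 < C ∧ WithHighProb P (fun N => {ω |
      ‖v N ω - signalVector N (h i)‖ ≤ C * (Real.log N ^ (ξ / 4) / θ N)}) := by
  -- Makes `τ = ξ / 4` admissible in the estimate for `W`.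
  have hξ : B + 1 < ξ / 4 := by
    have := (le_max_left _ _).trans_lt hθ.exponent
    linarith
  have hξ0 : 0 < ξ / 4 := by linarith
  obtain ⟨M, hM1, hM⟩ := exists_forall_abs_signal_le h_orth
  have hM0 : 0 < M := by linarith
  obtain ⟨G, hG0, hG⟩ := exists_abs_signalVector_dotProduct_sub_le h_orth h_lip
  obtain ⟨c₁, hc₁, hlow⟩ := hθ.lower.exists_pos
  obtain ⟨c₂, hc₂, hup⟩ := hθ.upper.exists_pos
  obtain ⟨C, hC, ρ₀, hρ₀, hdet⟩ := exists_abs_functional_sub_le hα_pos hα_anti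
    (γ := G * c₂) (by positivity) i
  refine ⟨C * M + c₂, by positivity, (withHighProb_norm_le_and_pow_mulVec_le hB hX
    (fun N j a => h j (gridPoint a) / M) (fun N j a => ?_) hξ).mono ?_⟩
  · rw [abs_div, abs_of_pos hM0, div_le_one hM0]
    exact hM j _ (gridPoint_mem_Icc a)
  have hT : Tendsto (fun N : ℕ => Real.log N ^ (ξ / 4)) atTop atTop :=
    (tendsto_rpow_atTop hξ0).comp tendsto_log_natCast_atTop
  filter_upwards [hlow.bound, hup.bound, eventually_gt_atTop (i : ℕ), eventually_ge_atTop 1,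
    tendsto_log_natCast_atTop.eventually_ge_atTop 1, hT.eventually_ge_atTop 1,
    hT.eventually_ge_atTop (c₁ / ρ₀), hT.eventually_ge_atTop (C * c₁ * Real.exp 2)]
    with N hlowN hupN hiN hN1 hlog hT1 hTρ hTC ω hω
  obtain ⟨hop, hpow⟩ := hω
  have hN1' : (1 : ℝ) ≤ N := by exact_mod_cast hN1
  have hN : (0 : ℝ) < N := by linarith
  have hsN : 0 < Real.sqrt N := Real.sqrt_pos.2 hN
  have hsN1 : 1 ≤ Real.sqrt N := Real.one_le_sqrt.2 hN1'
  have hθN : 0 < θ N := hθ_pos N hN1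
  have hl0 : 0 < Real.log N := by linarith
  set T := Real.log N ^ (ξ / 4) with hTdef
  have hT4 : Real.log N ^ ξ = T ^ 4 := by
    rw [hTdef, ← Real.rpow_mul_natCast hl0.le]
    congr 1
    push_cast
    ring
  rw [hT4, Real.norm_of_nonneg (by positivity), Real.norm_of_nonneg hθN.le] at hlowN
  rw [Real.norm_of_nonneg hθN.le, Real.norm_of_nonneg hN.le] at hupN
  set R := Real.sqrt N * T with hR
  have hR1 : 1 ≤ R := one_le_mul_of_one_le_of_one_le hsN1 hT1
  -- `T R = √N T²`, while the growth condition gives `√N T⁴ ≤ c₁ θ`.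
  have hRT : T * (R / θ N) ≤ c₁ := by
    rw [mul_div_assoc', div_le_iff₀ hθN]
    refine le_trans ?_ hlowN
    have h2 : T ^ 2 ≤ T ^ 4 := pow_le_pow_right₀ hT1 (by norm_num)
    calc T * R = Real.sqrt N * T ^ 2 := by rw [hR]; ring
      _ ≤ _ := mul_le_mul_of_nonneg_left h2 hsN.le
  have hTpos : 0 < T := by linarith
  have hρle : R / θ N ≤ c₁ / T := by rw [le_div_iff₀ hTpos, mul_comm]; exact hRT
  have hρ1 : R / θ N ≤ ρ₀ := by
    refine hρle.trans ?_
    rw [div_le_iff₀ hρ₀] at hTρ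
    rw [div_le_iff₀ hTpos]
    linarith
  -- Turns both the Gram error and the series remainder into `O(1 / θ)`.
  have hθinv : 1 / (N : ℝ) ≤ c₂ * (1 / θ N) := by
    rw [mul_one_div, div_le_div_iff₀ hN hθN]
    linarith
  have hCρ : C * (R / θ N) ≤ Real.exp (-2) := by
    have h1 : C * (R / θ N) ≤ C * (c₁ / T) := mul_le_mul_of_nonneg_left hρle hC.le
    refine h1.trans ?_
    rw [Real.exp_neg, ← one_div, mul_div_assoc', div_le_div_iff₀ hTpos (Real.exp_pos _), one_mul]
    exact hTC
  have hgγ : G / N ≤ G * c₂ * (R / θ N) := by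
    calc G / N = G * (1 / N) := by ring
      _ ≤ G * (c₂ * (1 / θ N)) := mul_le_mul_of_nonneg_left hθinv hG0
      _ ≤ G * (c₂ * (R / θ N)) := by gcongr
      _ = _ := by ring
  rw [Set.mem_ofPred_eq, pi_norm_le_iff_of_nonneg (by positivity)]
  intro a
  obtain ⟨hunit, heig⟩ := hv N hiN ω
  let φ : EuclideanSpace ℝ (Fin N) →ₗ[ℝ] ℝ :=
    (LinearMap.proj a).comp (WithLp.linearEquiv 2 ℝ (Fin N → ℝ)).toLinearMap
  have hsig (j : Fin k) : signalVector N (h j) =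
      (M / Real.sqrt N) • fun b : Fin N => h j (gridPoint b) / M := by
    funext b
    simp only [signalVector, Pi.smul_apply, smul_eq_mul]
    field_simp
  have key := hdet N (Fintype.card (Fin N))
    (Matrix.toEuclideanLin (perturbedMatrix (X N) (θ N) α h ω))
    (Matrix.toEuclideanLin (wignerMatrix (X N) ω))
    (Matrix.isSymmetric_toEuclideanLin_iff.mpr (perturbedMatrix_isHermitian (X N) (θ N) α h ω))
    finrank_euclideanSpace (θ N) R (G / N) (M / Real.sqrt N)
    (fun j => WithLp.toLp 2 (signalVector N (h j))) (WithLp.toLp 2 (v N ω)) ⌈Real.log N⌉₊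
    (by simpa using hiN) hθN (by linarith) (by positivity) (by positivity) hρ1 hgγ
    (toEuclideanLin_perturbedMatrix_apply (X N) (θ N) α h ω) hop
    (fun j l => by rw [inner_toLp_eq_dotProduct]; exact hG N (by omega) j l)
    (by
      rw [← sq_eq_sq₀ (norm_nonneg _) zero_le_one, ← real_inner_self_eq_norm_sq,
        inner_toLp_eq_dotProduct, hunit, one_pow])
    (by
      rw [Matrix.toLpLin_toLp, Matrix.toLin'_apply, heig]
      rfl)
    (by rw [inner_toLp_eq_dotProduct]; exact hv_sign N ω hiN)
    φ (fun x => PiLp.norm_apply_le x a)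
    (fun n hn j => by
      have h1 := hpow n hn j a
      rw [toEuclideanLin_pow_apply, hsig, Matrix.mulVec_smul]
      change |M / Real.sqrt N * _| ≤ _
      rw [abs_mul, abs_of_pos (by positivity)]
      exact mul_le_mul_of_nonneg_left h1 (by positivity))
  change |v N ω a - signalVector N (h i) a| ≤ _ at key
  change |v N ω a - signalVector N (h i) a| ≤ _
  refine key.trans ?_
  rw [add_mul]
  refine add_le_add (le_of_eq ?_) ?_
  -- With `b = M / √N`, the factor `√N` in `R` cancels and leaves `M T / θ`.
  · rw [hR]
    field_simp
  · calc (C * (R / θ N)) ^ (⌈Real.log N⌉₊ + 1) ≤ Real.exp (-2) ^ (⌈Real.log N⌉₊ + 1) :=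
          pow_le_pow_left₀ (by positivity) hCρ _
      _ = Real.exp (-(2 * (⌈Real.log N⌉₊ + 1))) := by
          rw [← Real.exp_nat_mul]; push_cast; ring_nf
      _ ≤ Real.exp (-Real.log N) := by
          apply Real.exp_le_exp.2
          linarith [Nat.le_ceil (Real.log N)]
      _ = 1 / N := by rw [Real.exp_neg, Real.exp_log hN, one_div]
      _ ≤ c₂ * (1 / θ N) := hθinv
      _ ≤ c₂ * (T / θ N) := by gcongr

end Delocalization

/-- The norm `‖·‖` on `Fin N → ℝ` below is the sup norm. -/
theorem mainTheorem6
    {Ω : ℕ → Type*} [∀ N, MeasurableSpace (Ω N)]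
    (P : ∀ N, Measure (Ω N)) [∀ N, IsProbabilityMeasure (P N)]
    (f : ℝ → ℝ → ℝ) (hf : IsVarianceProfile f)
    (B : ℝ) (hB : 0 < B)
    (X : ∀ N, Fin N → Fin N → Ω N → ℝ) (hX : ∀ N, IsWignerArray (P N) f B (X N))
    {k : ℕ} (α : Fin k → ℝ) (hα_pos : ∀ i, 0 < α i) (hα_anti : StrictAnti α)
    (h : Fin k → ℝ → ℝ) (h_orth : OrthonormalSignals h) (h_lip : LipschitzSignals h)
    (θ : ℕ → ℝ) (hθ_pos : ∀ N, 1 ≤ N → 0 < θ N)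
    (ξ : ℝ) (hθ : GrowthCondition B ξ θ)
    (i : Fin k)
    (v : ∀ N, Ω N → Fin N → ℝ)
    (hv : ∀ (N : ℕ) (hN : (i : ℕ) < N) (ω : Ω N),
      IsUnitEigenvector (perturbedMatrix_isHermitian (X N) (θ N) α h ω) i hN (v N ω))
    (hv_sign : ∀ (N : ℕ) (ω : Ω N), (i : ℕ) < N → 0 ≤ signalVector N (h i) ⬝ᵥ v N ω) :
    IsBigOhp P (fun N ω => ‖v N ω - signalVector N (h i)‖)
        (fun N _ => Real.log N ^ (ξ / 4) / θ N) ∧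
      IsLittleOhp P (fun N ω => ‖v N ω - signalVector N (h i)‖)
        (fun N _ => 1 / Real.sqrt N) ∧
      IsBigOhp P (fun N ω => ‖v N ω‖) (fun N _ => 1 / Real.sqrt N) := by
  obtain ⟨C, hC, hprob⟩ := withHighProb_norm_sub_signalVector_le P hB hX hα_pos hα_anti h_orth
    h_lip hθ_pos hθ i hv hv_sign
  obtain ⟨M, hM1, hM⟩ := exists_forall_abs_signal_le h_orth
  have hlittle : IsLittleOhp P (fun N ω => ‖v N ω - signalVector N (h i)‖)
      (fun N _ => 1 / Real.sqrt N) := by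
    intro δ hδ
    obtain ⟨c₁, hc₁, hlow⟩ := hθ.lower.exists_pos
    have hξ : 8 < ξ := (le_max_right _ _).trans_lt hθ.exponent
    refine hprob.mono ?_
    filter_upwards [hlow.bound, eventually_ge_atTop 1,
      tendsto_log_natCast_atTop.eventually_ge_atTop 1,
      -- The spare power of `log N` between `ξ / 4` and `ξ` beats any constant, whence the little-o
      -- statement.
      eventually_mul_rpow_log_le (show ξ / 4 < ξ by linarith) (C * c₁ / δ)]
      with N hlowN hN1 hlog hTN ω hω
    have hN : (0 : ℝ) < N := by exact_mod_cast hN1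
    have hθN := hθ_pos N hN1
    have hl0 : 0 < Real.log N := by linarith
    have hsN : 0 < Real.sqrt N := Real.sqrt_pos.2 hN
    rw [Real.norm_of_nonneg (by positivity), Real.norm_of_nonneg hθN.le] at hlowN
    rw [Set.mem_ofPred_eq] at hω ⊢
    rw [abs_of_nonneg (norm_nonneg _), abs_of_nonneg (by positivity)]
    refine hω.trans ?_
    rw [mul_div_assoc', mul_one_div, div_le_div_iff₀ hθN hsN]
    refine le_of_mul_le_mul_right ?_ hc₁
    calc C * Real.log N ^ (ξ / 4) * Real.sqrt N * c₁
        = δ * (Real.sqrt N * (C * c₁ / δ * Real.log N ^ (ξ / 4))) := by field_simp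
      _ ≤ δ * (Real.sqrt N * Real.log N ^ ξ) := by gcongr
      _ ≤ δ * (c₁ * θ N) := by gcongr
      _ = _ := by ring
  refine ⟨⟨C, hC, hprob.mono ?_⟩, hlittle, M + 1, by linarith, (hlittle 1 one_pos).mono ?_⟩
  · filter_upwards [eventually_ge_atTop 1] with N hN1 ω hω
    rw [Set.mem_ofPred_eq] at hω ⊢
    rw [abs_of_nonneg (norm_nonneg _)]
    exact hω.trans (mul_le_mul_of_nonneg_left (le_abs_self _) hC.le)
  · refine Eventually.of_forall fun N ω hω => ?_
    rw [Set.mem_ofPred_eq] at hω ⊢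
    rw [abs_of_nonneg (norm_nonneg _), abs_of_nonneg (by positivity)] at hω ⊢
    have hsig : ‖signalVector N (h i)‖ ≤ M * (1 / Real.sqrt N) := by
      rw [pi_norm_le_iff_of_nonneg (by positivity)]
      intro a
      rw [signalVector, Real.norm_eq_abs, abs_div, abs_of_nonneg (Real.sqrt_nonneg _),
        div_eq_mul_one_div]
      exact mul_le_mul_of_nonneg_right (hM i _ (gridPoint_mem_Icc a)) (by positivity)
    calc ‖v N ω‖ = ‖(v N ω - signalVector N (h i)) + signalVector N (h i)‖ := by
          rw [sub_add_cancel]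
      _ ≤ 1 * (1 / Real.sqrt N) + M * (1 / Real.sqrt N) :=
          (norm_add_le _ _).trans (add_le_add hω hsig)
      _ = _ := by ring
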